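/- Let $n,r,m,d$ be non-negative integers with $r<n$, and let $f_1,\dots,f_m\in\mathbb{C}[x_0,\dots,x_n]$ be homogeneous polynomials of the same degree $d$ (the zero polynomial is allowed) such that their common zero locus $V=\mathbb{V}(f_1,\dots,f_m)\subset\mathbb{P}^n$ is pure dimensional of dimension $r$; that is, $V$ has dimension $r$ and every irreducible component of $V$ has dimension $r$. Here a projective variety $X\subset\mathbb{P}^n$ has dimension $r$ if every linear subspace of $\mathbb{P}^n$ of dimension at least $n-r$ meets $X$ and, for every $s\le n-r-1$, the generic linear subspace of dimension $s$ is disjoint from $X$. For a matrix $\Lambda=(\lambda_{ij})\in\mathbb{C}^{k\times m}$ let $\Lambda_{\boldsymbol f}$ be the system of the $k$ polynomials $\sum_{j=1}^m\lambda_{ij}f_j$, $1\le i\le k$, and $\mathbb{V}(\Lambda_{\boldsymbol f})\subset\mathbb{P}^n$ its common zero locus. Put $$N=\left\lceil\frac{m}{n-r}\right\rceil .$$ Then there is a hypersurface $H\subset\mathbb{C}^{N(n-r)\times m}$ (the zero set of a nonconstant polynomial) of degree at most $N(n-r)d^{\,n-r-1}+m$ such that for all matrices $\Lambda^1,\dots,\Lambda^N\in\mathbb{C}^{(n-r)\times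 m}$ with $(\Lambda^1,\dots,\Lambda^N)\notin H$, each variety $\mathbb{V}(\Lambda^i_{\boldsymbol f})$, $1\le i\le N$, is pure dimensional of dimension $r$, and $$V=\bigcap_{i=1}^N\mathbb{V}(\Lambda^i_{\boldsymbol f}).$$ In particular, both properties hold for a generic choice of $\Lambda^1,\dots,\Lambda^N$. Moreover $N(n-r)d^{\,n-r-1}+m=O(m\,d^{\,n-r-1})$ with an absolute implied constant: there is a constant $C$, independent of $n,r,m,d$ and the $f_j$, with $N(n-r)d^{\,n-r-1}+m\le C\,m\,d^{\,n-r-1}$ in every such situation. -/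

import Mathlib

open scoped LinearAlgebra.Projectivization

/-- Complex projective space `ℙⁿ`: lines through the origin in `ℂ^(n+1)`. -/
abbrev CProj (n : ℕ) : Type := ℙ ℂ (Fin (n + 1) → ℂ)

/-- The common zero locus in `ℙⁿ` of a family of polynomials in `x₀, …, xₙ`. It is only used for
homogeneous polynomials, for which the choice of the representative does not matter
(see `mk_mem_projZeroLocus`). -/
def projZeroLocus {n : ℕ} {ι : Type*} (F : ι → MvPolynomial (Fin (n + 1)) ℂ) : Set (CProj n) :=
  {p | ∀ i, MvPolynomial.eval p.rep (F i) = 0}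

theorem mk_mem_projZeroLocus {n : ℕ} {ι : Type*} {F : ι → MvPolynomial (Fin (n + 1)) ℂ}
    (hF : ∀ i, ∃ e, (F i).IsHomogeneous e) (v : Fin (n + 1) → ℂ) (hv : v ≠ 0) :
    Projectivization.mk ℂ v hv ∈ projZeroLocus F ↔ ∀ i, MvPolynomial.eval v (F i) = 0 := by
  obtain ⟨a, ha⟩ := Projectivization.exists_smul_eq_mk_rep ℂ v hv
  refine forall_congr' fun i => ?_
  obtain ⟨e, he⟩ := hF i
  rw [← ha]
  have h : MvPolynomial.eval (a • v) (F i) = (a : ℂ) ^ e * MvPolynomial.eval v (F i) := by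
    rw [MvPolynomial.eval_eq, MvPolynomial.eval_eq, Finset.mul_sum]
    refine Finset.sum_congr rfl fun c hc => ?_
    have hdeg : ∑ j ∈ c.support, c j = e := by
      have := he (MvPolynomial.mem_support_iff.mp hc)
      simpa [Finsupp.weight_apply, Finsupp.sum] using this
    have hsmul : ∀ j, (a • v) j = (a : ℂ) * v j := fun j => rfl
    simp only [hsmul, mul_pow, Finset.prod_mul_distrib, Finset.prod_pow_eq_pow_sum, hdeg]
    ring
  rw [h]
  simp

/-- Projective varieties in `ℙⁿ`: zero loci of finitely many homogeneous polynomials (not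
necessarily of the same degree). They need not be irreducible. -/
def IsProjVariety {n : ℕ} (X : Set (CProj n)) : Prop :=
  ∃ (k : ℕ) (F : Fin k → MvPolynomial (Fin (n + 1)) ℂ),
    (∀ i, ∃ e, (F i).IsHomogeneous e) ∧ X = projZeroLocus F

/-- An irreducible variety: nonempty and not the union of two proper subvarieties. -/
def IsIrreducibleVariety {n : ℕ} (X : Set (CProj n)) : Prop :=
  IsProjVariety X ∧ X.Nonempty ∧
    ∀ Y Z : Set (CProj n), IsProjVariety Y → IsProjVariety Z → X = Y ∪ Z → X = Y ∨ X = Z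

/-- `X` is an irreducible component of `V`: a maximal irreducible subvariety of `V`. -/
def IsIrreducibleComponent {n : ℕ} (X V : Set (CProj n)) : Prop :=
  IsIrreducibleVariety X ∧ X ⊆ V ∧
    ∀ Y : Set (CProj n), IsIrreducibleVariety Y → Y ⊆ V → X ⊆ Y → Y = X

/-- The projective linear subspace `ℙ(W) ⊆ ℙⁿ`, of projective dimension `finrank W - 1`. -/
def projLinearSubspace {n : ℕ} (W : Submodule ℂ (Fin (n + 1) → ℂ)) : Set (CProj n) :=
  {p | p.submodule ≤ W}

/-- A property of linear subspaces of `ℂ^(n+1)` holds for the generic `s`-dimensional one: it holds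
for the span of every linearly independent `s`-tuple of vectors at which a certain nonzero
polynomial in the `s * (n + 1)` coordinates does not vanish. -/
def ForGenericSubspace (n s : ℕ) (Q : Submodule ℂ (Fin (n + 1) → ℂ) → Prop) : Prop :=
  ∃ P : MvPolynomial (Fin s × Fin (n + 1)) ℂ, P ≠ 0 ∧
    ∀ A : Fin s → Fin (n + 1) → ℂ, LinearIndependent ℂ A →
      MvPolynomial.eval (fun ij => A ij.1 ij.2) P ≠ 0 → Q (Submodule.span ℂ (Set.range A))

/-- The variety `V ⊆ ℙⁿ` has dimension `r`: every linear subspace `L ⊆ ℙⁿ` of projective dimension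
at least `n - r` meets `V`, and the generic linear subspace of any given projective dimension
at most `n - r - 1` is disjoint from `V`. (A subspace `W` of `ℂ^(n+1)` of dimension `s` gives a
linear subspace of projective dimension `s - 1`.) -/
def HasProjDim {n : ℕ} (V : Set (CProj n)) (r : ℕ) : Prop :=
  (∀ W : Submodule ℂ (Fin (n + 1) → ℂ), n + 1 ≤ Module.finrank ℂ W + r →
      (projLinearSubspace W ∩ V).Nonempty) ∧
    ∀ s : ℕ, s + r ≤ n → ForGenericSubspace n s fun W => Disjoint (projLinearSubspace W) V

/-- `V` is a pure dimensional variety of dimension `r`: it has dimension `r`, and so has each of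
its irreducible components. -/
def IsPureDimensional {n : ℕ} (V : Set (CProj n)) (r : ℕ) : Prop :=
  IsProjVariety V ∧ HasProjDim V r ∧
    ∀ X : Set (CProj n), IsIrreducibleComponent X V → HasProjDim X r

/-- The system `Λ_f` of linear combinations `∑ⱼ Λᵢⱼ fⱼ`, one for each row of `Λ`. -/
noncomputable def lambdaSystem {n k m : ℕ} (Λ : Matrix (Fin k) (Fin m) ℂ)
    (f : Fin m → MvPolynomial (Fin (n + 1)) ℂ) : Fin k → MvPolynomial (Fin (n + 1)) ℂ :=
  fun i => ∑ j, MvPolynomial.C (Λ i j) * f j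

/-- `H ⊆ ℂ^σ` is a hypersurface of degree at most `D`: the zero set of a nonconstant polynomial of
total degree at most `D`. -/
def IsHypersurfaceOfDegreeLE {σ : Type*} (H : Set (σ → ℂ)) (D : ℕ) : Prop :=
  ∃ P : MvPolynomial σ ℂ, 0 < P.totalDegree ∧ P.totalDegree ≤ D ∧
    H = {a | MvPolynomial.eval a P = 0}

/-!
Put `k = n - r` and fix a linear subspace `L ⊆ ℙⁿ` of dimension `k - 1` that is disjoint from `V`.
The statement follows from two facts.

*Disjointness from `L` implies purity* (`isPureDimensional_of_linearIndependent`). Let `h` be `k`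
forms of positive degree without common zeros on `L`, and `y` the `r + 1` linear forms that cut out
`L`. By the Nullstellensatz `ℂ[x]` is integral over `ℂ[h, y]`, which is therefore a polynomial ring.
Going down shows that a minimal prime `𝔮` of `(h)` contracts to the ideal generated by `h` in this
ring, so `y` stays algebraically independent modulo `𝔮`. If the zero locus of `𝔮` missed a linear
subspace cut out by at most `r` linear forms, then `ℂ[x] / 𝔮` would be integral over the algebra
generated by these, which has too small a transcendence degree. The irreducible components of
`𝕍(h)` are the zero loci of its minimal primes.

*The combinations `Λ_f` with a zero on `L` lie in a hypersurface of degree at most `k d^(k-1)`*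
(`exists_chowForm`). On `L` the `f` restrict to forms `g` of degree `d` in `k` variables. After
adding `x₁^d, …, x_k^d` to them, the matrices `Λ` of the degenerate systems of `k` combinations form
an irreducible set, with a prime ideal that contains no nonzero polynomial independent of the
coefficient of `x_a^d` in the equation `a`. By Gauss's lemma this ideal is generated by one
polynomial `R`, the resultant. Macaulay's determinant, set up to use the equation `a` only for the
`d^(k-1)` monomials where it is unavoidable, is a multiple of `R`, hence the degree of `R` in each
row is at most `d^(k-1)`. Finally, `R` does not vanish at any nondegenerate system, because another
determinant in the ideal does not, and some system of combinations of the `g` alone is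
nondegenerate, by linear projections.

The hypersurface `H` is the union of those for `Λ¹, …, Λᴺ` and of the zero set of a maximal minor
of the stacked matrix of all `Λⁱ`. This minor has degree `m`, and where it does not vanish, the
combinations of the `f` span the same space as the `f`.
-/

/-! ### Homogeneous combinations and integrality -/

namespace MvPolynomial

theorem homogeneousComponent_mul_of_isHomogeneous {σ R : Type*} [CommSemiring R]
    {q : MvPolynomial σ R} {d : ℕ} (hq : q.IsHomogeneous d) (p : MvPolynomial σ R) (e : ℕ) :
    homogeneousComponent e (p * q) =
      if d ≤ e then homogeneousComponent (e - d) p * q else 0 := by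
  conv_lhs => rw [← sum_homogeneousComponent p, Finset.sum_mul, map_sum]
  have h : ∀ i, homogeneousComponent e (homogeneousComponent i p * q) =
      if i + d = e then homogeneousComponent i p * q else 0 := fun i => by
    rw [homogeneousComponent_of_mem ((homogeneousComponent_isHomogeneous i p).mul hq)]
    simp only [eq_comm]
  simp only [h]
  split_ifs with hd
  · rw [Finset.sum_eq_single (e - d)]
    · rw [if_pos (by omega)]
    · intro b _ hb
      rw [if_neg (by omega)]
    · intro hb
      rw [if_pos (by omega), homogeneousComponent_eq_zero _ _ ?_, zero_mul]
      simp only [Finset.mem_range] at hb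
      omega
  · exact Finset.sum_eq_zero fun i _ => if_neg (by omega)

/-- A form in a sum of an ideal `J` stable under taking homogeneous components and of an ideal
generated by forms is a combination with homogeneous coefficients. -/
theorem IsHomogeneous.exists_eq_add_sum {σ ι R : Type*} [CommRing R] [Fintype ι]
    {J : Ideal (MvPolynomial σ R)} (hJ : ∀ p ∈ J, ∀ n, homogeneousComponent n p ∈ J)
    {y : ι → MvPolynomial σ R} {d : ι → ℕ} (hy : ∀ i, (y i).IsHomogeneous (d i))
    {p : MvPolynomial σ R} {e : ℕ} (hp : p.IsHomogeneous e)
    (hmem : p ∈ J ⊔ Ideal.span (Set.range y)) :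
    ∃ j ∈ J, ∃ c : ι → MvPolynomial σ R, (∀ i, (c i).IsHomogeneous (e - d i)) ∧
      (∀ i, e < d i → c i = 0) ∧ p = j + ∑ i, c i * y i := by
  obtain ⟨j, hj, s, hs, rfl⟩ := Submodule.mem_sup.mp hmem
  obtain ⟨c, rfl⟩ := Ideal.mem_span_range_iff_exists_fun.mp hs
  refine ⟨homogeneousComponent e j, hJ _ hj e,
    fun i => if d i ≤ e then homogeneousComponent (e - d i) (c i) else 0, fun i => ?_,
    fun i hi => if_neg (by omega), ?_⟩
  · dsimp only
    split_ifs
    · exact homogeneousComponent_isHomogeneous _ _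
    · exact isHomogeneous_zero _ _ _
  · conv_lhs => rw [← homogeneousComponent_eq_self hp, map_add, map_sum]
    congr 1
    refine Finset.sum_congr rfl fun i _ => ?_
    rw [homogeneousComponent_mul_of_isHomogeneous (hy i), ite_mul, zero_mul]

/-- The homogeneous Nullstellensatz: an ideal whose only possible zero is the origin contains a
power of the irrelevant ideal. -/
theorem exists_pow_idealOfVars_le {σ : Type*} [Finite σ] {I : Ideal (MvPolynomial σ ℂ)}
    (hI : ∀ v : σ → ℂ, (∀ p ∈ I, eval v p = 0) → v = 0) :
    ∃ t, idealOfVars σ ℂ ^ t ≤ I := by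
  refine Ideal.exists_pow_le_of_le_radical_of_fg ?_ (idealOfVars_fg σ ℂ)
  rw [← vanishingIdeal_zeroLocus_eq_radical (K := ℂ), idealOfVars, Ideal.span_le]
  rintro _ ⟨i, rfl⟩ v hv
  have := hI v fun p hp => by simpa [aeval_eq_eval] using hv p hp
  simp [this]

theorem IsHomogeneous.degree_eq_of_mem_support {σ R : Type*} [CommSemiring R]
    {p : MvPolynomial σ R} {e : ℕ} (hp : p.IsHomogeneous e) {x : σ →₀ ℕ} (hx : x ∈ p.support) :
    x.degree = e := by
  by_contra h
  exact mem_support_iff.mp hx (hp.coeff_eq_zero h)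

theorem IsHomogeneous.mem_pow_idealOfVars {σ R : Type*} [CommRing R] {p : MvPolynomial σ R}
    {e t : ℕ} (hp : p.IsHomogeneous e) (h : t ≤ e) : p ∈ idealOfVars σ R ^ t := by
  rw [mem_pow_idealOfVars_iff]
  intro x hx
  rwa [hp.degree_eq_of_mem_support hx]

/-- If `J` is a homogeneous ideal and `y` are forms of positive degree without common zeros on the
cone of `J` except for the vertex, then `ℂ[x] / J` is integral over `ℂ[y]`. -/
theorem isIntegral_adjoin_of_forall_eval_eq_zero {σ ι B : Type*} [Finite σ] [Fintype ι]
    [CommRing B] [Algebra ℂ B] {π : MvPolynomial σ ℂ →ₐ[ℂ] B} (hπ : Function.Surjective π)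
    (hJ : ∀ p ∈ RingHom.ker π, ∀ n, homogeneousComponent n p ∈ RingHom.ker π)
    {y : ι → MvPolynomial σ ℂ} {d : ι → ℕ} (hy : ∀ i, (y i).IsHomogeneous (d i))
    (hd : ∀ i, 0 < d i)
    (h0 : ∀ v : σ → ℂ, (∀ p ∈ RingHom.ker π, eval v p = 0) → (∀ i, eval v (y i) = 0) → v = 0) :
    Algebra.IsIntegral (Algebra.adjoin ℂ (Set.range (π ∘ y))) B := by
  obtain ⟨t, ht⟩ : ∃ t, idealOfVars σ ℂ ^ t ≤ RingHom.ker π ⊔ Ideal.span (Set.range y) := by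
    refine exists_pow_idealOfVars_le fun v hv => h0 v (fun p hp => hv p ?_) fun i => hv _ ?_
    · exact Ideal.mem_sup_left hp
    · exact Ideal.mem_sup_right (Ideal.subset_span ⟨i, rfl⟩)
  set S := Algebra.adjoin ℂ (Set.range (π ∘ y)) with hS
  have hfin : {β : σ →₀ ℕ | β.degree ≤ t}.Finite := Finsupp.finite_of_degree_le t
  set N : Submodule S B := Submodule.span S ((fun β => π (monomial β 1)) '' {β | β.degree ≤ t})
    with hN
  -- Modulo the kernel, a form of degree `≥ t` is a combination of the `y` with coefficients of lower
  -- degree, so the monomials of degree `≤ t` generate `B` as a module over `ℂ[y]`.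
  have key : ∀ e (p : MvPolynomial σ ℂ), p.IsHomogeneous e → π p ∈ N := by
    intro e
    induction e using Nat.strong_induction_on with
    | _ e ih =>
      intro p hp
      by_cases he : t ≤ e
      · obtain ⟨j, hj, c, hc, hc0, rfl⟩ :=
          hp.exists_eq_add_sum hJ hy (ht (hp.mem_pow_idealOfVars he))
        rw [map_add, (RingHom.mem_ker).mp hj, zero_add, map_sum]
        refine Submodule.sum_mem _ fun i _ => ?_
        rcases lt_or_ge e (d i) with h | h
        · simp [hc0 i h]
        · have h1 := ih (e - d i) (by have := hd i; omega) (c i) (hc i)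
          rw [map_mul, mul_comm]
          exact N.smul_mem (⟨π (y i), Algebra.subset_adjoin ⟨i, rfl⟩⟩ : S) h1
      · rw [p.as_sum, map_sum]
        refine Submodule.sum_mem _ fun β hβ => ?_
        have hb : monomial β (coeff β p) = coeff β p • monomial β (1 : ℂ) := by
          simp [smul_monomial]
        rw [hb, map_smul, ← algebraMap_smul S]
        refine N.smul_mem _ (Submodule.subset_span ⟨β, ?_, rfl⟩)
        have := hp.degree_eq_of_mem_support hβ
        exact (by omega : β.degree ≤ t)
  have htop : N = ⊤ := by
    rw [eq_top_iff]
    rintro b -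
    obtain ⟨p, rfl⟩ := hπ b
    rw [← sum_homogeneousComponent p, map_sum]
    exact Submodule.sum_mem _ fun i _ => key i _ (homogeneousComponent_isHomogeneous i p)
  have : Module.Finite S B := ⟨htop ▸ Submodule.fg_span (hfin.image _)⟩
  infer_instance

theorem isIntegral_adjoin_range_of_forall_eval_eq_zero {σ ι : Type*} [Finite σ] [Fintype ι]
    {y : ι → MvPolynomial σ ℂ} {d : ι → ℕ} (hy : ∀ i, (y i).IsHomogeneous (d i))
    (hd : ∀ i, 0 < d i) (h0 : ∀ v : σ → ℂ, (∀ i, eval v (y i) = 0) → v = 0) :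
    Algebra.IsIntegral (Algebra.adjoin ℂ (Set.range y)) (MvPolynomial σ ℂ) := by
  refine isIntegral_adjoin_of_forall_eval_eq_zero (π := AlgHom.id ℂ (MvPolynomial σ ℂ))
    Function.surjective_id (fun p hp n => ?_) hy hd fun v _ => h0 v
  rw [show p = 0 from hp, map_zero]
  exact Ideal.zero_mem _

/-- Forms of positive degree without common nontrivial zeros are at least as many as the
variables. -/
theorem card_le_card_of_forall_eval_eq_zero {σ ι : Type} [Fintype σ] [Fintype ι]
    {y : ι → MvPolynomial σ ℂ} {d : ι → ℕ} (hy : ∀ i, (y i).IsHomogeneous (d i))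
    (hd : ∀ i, 0 < d i) (h0 : ∀ v : σ → ℂ, (∀ i, eval v (y i) = 0) → v = 0) :
    Fintype.card σ ≤ Fintype.card ι := by
  have := isIntegral_adjoin_range_of_forall_eval_eq_zero hy hd h0
  have h := Algebra.IsAlgebraic.trdeg_le_cardinalMk ℂ (Set.range y)
  rw [MvPolynomial.trdeg_of_isDomain] at h
  have h2 := h.trans Cardinal.mk_range_le
  simpa using h2

theorem algebraicIndependent_of_forall_eval_eq_zero {σ ι : Type} [Fintype σ] [Fintype ι]
    {y : ι → MvPolynomial σ ℂ} {d : ι → ℕ} (hy : ∀ i, (y i).IsHomogeneous (d i))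
    (hd : ∀ i, 0 < d i) (h0 : ∀ v : σ → ℂ, (∀ i, eval v (y i) = 0) → v = 0)
    (hcard : Fintype.card ι ≤ Fintype.card σ) : AlgebraicIndependent ℂ y := by
  have := isIntegral_adjoin_range_of_forall_eval_eq_zero hy hd h0
  refine (Algebra.IsAlgebraic.isTranscendenceBasis_of_le_trdeg_of_finite ℂ y ?_).1
  rw [MvPolynomial.trdeg_of_isDomain]
  simpa using hcard

end MvPolynomial

/-! ### Minimal primes of complete intersections -/

namespace MvPolynomial

/-- Let the forms `h` and `y` be as many as the variables and without common nontrivial zeros.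
Going down for `ℂ[h, y] ⊆ ℂ[x]` shows that every minimal prime `𝔮` of `(h)` contracts to the ideal
of `ℂ[h, y]` generated by `h`, so that `y` stays algebraically independent modulo `𝔮`. -/
theorem algebraicIndependent_mk_of_mem_minimalPrimes {σ κ ρ : Type} [Fintype σ] [Fintype κ]
    [Fintype ρ] {h : κ → MvPolynomial σ ℂ} {y : ρ → MvPolynomial σ ℂ} {dh : κ → ℕ} {dy : ρ → ℕ}
    (hh : ∀ i, (h i).IsHomogeneous (dh i)) (hy : ∀ i, (y i).IsHomogeneous (dy i))
    (hdh : ∀ i, 0 < dh i) (hdy : ∀ i, 0 < dy i)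
    (h0 : ∀ v : σ → ℂ, (∀ i, eval v (h i) = 0) → (∀ i, eval v (y i) = 0) → v = 0)
    (hcard : Fintype.card κ + Fintype.card ρ ≤ Fintype.card σ)
    {𝔮 : Ideal (MvPolynomial σ ℂ)} (h𝔮 : 𝔮 ∈ (Ideal.span (Set.range h)).minimalPrimes) :
    AlgebraicIndependent ℂ (Ideal.Quotient.mkₐ ℂ 𝔮 ∘ y) := by
  have hF : ∀ i, (Sum.elim h y i).IsHomogeneous (Sum.elim dh dy i) := by
    rintro (i | i)
    exacts [hh i, hy i]
  have hdF : ∀ i, 0 < Sum.elim dh dy i := by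
    rintro (i | i)
    exacts [hdh i, hdy i]
  have h0F : ∀ v : σ → ℂ, (∀ i, eval v (Sum.elim h y i) = 0) → v = 0 := fun v hv =>
    h0 v (fun i => hv (Sum.inl i)) fun i => hv (Sum.inr i)
  have hint := isIntegral_adjoin_range_of_forall_eval_eq_zero hF hdF h0F
  have hind := algebraicIndependent_of_forall_eval_eq_zero hF hdF h0F (by simpa using hcard)
  have h𝔮p : 𝔮.IsPrime := h𝔮.1.1
  set F := Sum.elim h y with hFdef
  let φ : MvPolynomial (κ ⊕ ρ) ℂ →ₐ[ℂ] MvPolynomial σ ℂ := aeval F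
  let _ : Algebra (MvPolynomial (κ ⊕ ρ) ℂ) (MvPolynomial σ ℂ) := φ.toRingHom.toAlgebra
  have hmap : ∀ p, algebraMap (MvPolynomial (κ ⊕ ρ) ℂ) (MvPolynomial σ ℂ) p = φ p := fun _ => rfl
  have : FaithfulSMul (MvPolynomial (κ ⊕ ρ) ℂ) (MvPolynomial σ ℂ) :=
    (faithfulSMul_iff_algebraMap_injective _ _).mpr hind
  have : Algebra.IsIntegral (MvPolynomial (κ ⊕ ρ) ℂ) (MvPolynomial σ ℂ) := by
    have hr : φ.range = Algebra.adjoin ℂ (Set.range F) :=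
      (Algebra.adjoin_range_eq_range_aeval ℂ F).symm
    rw [← hr] at hint
    have h1 : (φ.rangeRestrict.toRingHom).IsIntegral :=
      RingHom.isIntegral_of_surjective _ φ.rangeRestrict_surjective
    have h2 : (algebraMap φ.range (MvPolynomial σ ℂ)).IsIntegral :=
      Algebra.IsIntegral.isIntegral
    exact ⟨RingHom.IsIntegral.trans _ _ h1 h2⟩
  -- The projection of `ℂ[h, y]` to `ℂ[y]`; its kernel is generated by `h`.
  let pr : MvPolynomial (κ ⊕ ρ) ℂ →ₐ[ℂ] MvPolynomial ρ ℂ := aeval (Sum.elim 0 X)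
  have hcomm : (Ideal.Quotient.mkₐ ℂ 𝔮).comp φ =
      (aeval (Ideal.Quotient.mkₐ ℂ 𝔮 ∘ y)).comp pr := by
    refine algHom_ext fun i => ?_
    rcases i with i | i
    · have : h i ∈ 𝔮 := h𝔮.1.2 (Ideal.subset_span ⟨i, rfl⟩)
      simpa [φ, pr, F, Ideal.Quotient.eq_zero_iff_mem] using this
    · simp [φ, pr, F]
  have hpr : RingHom.ker pr ≤ 𝔮.under (MvPolynomial (κ ⊕ ρ) ℂ) := by
    intro p hp
    have := DFunLike.congr_fun hcomm p
    rw [AlgHom.comp_apply, AlgHom.comp_apply, RingHom.mem_ker.mp hp, map_zero] at this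
    exact Ideal.mem_comap.mpr (Ideal.Quotient.eq_zero_iff_mem.mp this)
  have hprr : ∀ p, pr (rename Sum.inr p) = p := fun p => by
    simp only [pr, aeval_rename, Sum.elim_comp_inr, aeval_X_left_apply]
  have : (RingHom.ker pr).IsPrime := RingHom.ker_isPrime _
  obtain ⟨P, hPle, hP, hover⟩ :=
    Ideal.exists_ideal_le_liesOver_of_le (p := RingHom.ker pr)
      (q := 𝔮.under (MvPolynomial (κ ⊕ ρ) ℂ)) 𝔮 hpr
  have hPq : P = 𝔮 := by
    refine le_antisymm hPle (h𝔮.2 ⟨hP, ?_⟩ hPle)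
    rw [Ideal.span_le]
    rintro _ ⟨i, rfl⟩
    have h1 : (X (Sum.inl i) : MvPolynomial (κ ⊕ ρ) ℂ) ∈ RingHom.ker pr := by
      simp [pr, RingHom.mem_ker]
    rw [hover.over] at h1
    simpa [Ideal.mem_comap, hmap, φ, F] using h1
  rw [algebraicIndependent_iff_injective_aeval, injective_iff_map_eq_zero]
  intro p hp
  have h1 : rename Sum.inr p ∈ RingHom.ker pr := by
    rw [hover.over, hPq]
    have h2 : Ideal.Quotient.mkₐ ℂ 𝔮 (φ (rename Sum.inr p)) = 0 := by
      rw [← AlgHom.comp_apply, hcomm, AlgHom.comp_apply, hprr, hp]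
    exact Ideal.mem_comap.mpr (Ideal.Quotient.eq_zero_iff_mem.mp h2)
  rwa [RingHom.mem_ker, hprr] at h1

/-- The zero locus of a homogeneous minimal prime of the complete intersection `h` meets the zero
locus of any family of forms with fewer members than `y`. -/
theorem exists_ne_zero_of_mem_minimalPrimes {σ κ ρ τ : Type} [Fintype σ] [Fintype κ]
    [Fintype ρ] [Fintype τ] {h : κ → MvPolynomial σ ℂ} {y : ρ → MvPolynomial σ ℂ}
    {dh : κ → ℕ} {dy : ρ → ℕ}
    (hh : ∀ i, (h i).IsHomogeneous (dh i)) (hy : ∀ i, (y i).IsHomogeneous (dy i))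
    (hdh : ∀ i, 0 < dh i) (hdy : ∀ i, 0 < dy i)
    (h0 : ∀ v : σ → ℂ, (∀ i, eval v (h i) = 0) → (∀ i, eval v (y i) = 0) → v = 0)
    (hcard : Fintype.card κ + Fintype.card ρ ≤ Fintype.card σ)
    {𝔮 : Ideal (MvPolynomial σ ℂ)} (h𝔮 : 𝔮 ∈ (Ideal.span (Set.range h)).minimalPrimes)
    (hhom : ∀ p ∈ 𝔮, ∀ n, homogeneousComponent n p ∈ 𝔮)
    {ℓ : τ → MvPolynomial σ ℂ} {dl : τ → ℕ} (hl : ∀ i, (ℓ i).IsHomogeneous (dl i))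
    (hdl : ∀ i, 0 < dl i) (hτ : Fintype.card τ < Fintype.card ρ) :
    ∃ v : σ → ℂ, v ≠ 0 ∧ (∀ p ∈ 𝔮, eval v p = 0) ∧ ∀ i, eval v (ℓ i) = 0 := by
  by_contra! hcon
  have h𝔮p : 𝔮.IsPrime := h𝔮.1.1
  have hker : RingHom.ker (Ideal.Quotient.mkₐ ℂ 𝔮) = 𝔮 := Ideal.Quotient.mkₐ_ker ℂ 𝔮
  have hint := isIntegral_adjoin_of_forall_eval_eq_zero (π := Ideal.Quotient.mkₐ ℂ 𝔮)
    (Ideal.Quotient.mkₐ_surjective ℂ 𝔮) (by rwa [hker]) hl hdl (fun v hv hv' => by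
      by_contra hne
      rw [hker] at hv
      obtain ⟨i, hi⟩ := hcon v hne hv
      exact hi (hv' i))
  have : Algebra.IsAlgebraic (Algebra.adjoin ℂ (Set.range (Ideal.Quotient.mkₐ ℂ 𝔮 ∘ ℓ)))
      (MvPolynomial σ ℂ ⧸ 𝔮) := hint.isAlgebraic
  have h1 := Algebra.IsAlgebraic.trdeg_le_cardinalMk ℂ
    (Set.range (Ideal.Quotient.mkₐ ℂ 𝔮 ∘ ℓ))
  have h2 := (algebraicIndependent_mk_of_mem_minimalPrimes hh hy hdh hdy h0 hcard
    h𝔮).cardinalMk_le_trdeg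
  have h3 := (h2.trans h1).trans Cardinal.mk_range_le
  simp only [Cardinal.mk_fintype, Nat.cast_le] at h3
  omega

end MvPolynomial

/-! ### Macaulay determinants -/

namespace MvPolynomial

/-- The monomials of degree `T` in the variables `τ`, encoded by their exponents. -/
abbrev ExponentOfDegree (τ : Type*) (T : ℕ) : Type _ := {β : τ →₀ ℕ // β.degree = T}

instance {τ : Type*} [Finite τ] (T : ℕ) : Finite (ExponentOfDegree τ T) :=
  (Finsupp.finite_of_degree_le T).subset fun _ h => le_of_eq h

noncomputable instance {τ : Type*} [Finite τ] (T : ℕ) : Fintype (ExponentOfDegree τ T) :=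
  Fintype.ofFinite _

/-- The determinant of the coefficient matrix of a family of forms of degree `T` indexed by the
monomials of degree `T`. -/
noncomputable def coeffDet {τ S : Type*} [Finite τ] [CommRing S] {T : ℕ}
    (c : ExponentOfDegree τ T → MvPolynomial τ S) : S :=
  open Classical in (Matrix.of fun β β' : ExponentOfDegree τ T => coeff β.1 (c β')).det

section coeffDet

variable {τ S : Type*} [Finite τ] [CommRing S] {T : ℕ}

theorem coeffDet_eq_det [DecidableEq (ExponentOfDegree τ T)]
    (c : ExponentOfDegree τ T → MvPolynomial τ S) :
    coeffDet c = (Matrix.of fun β β' : ExponentOfDegree τ T => coeff β.1 (c β')).det := by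
  rw [coeffDet]
  congr!

theorem map_coeffDet {S' : Type*} [CommRing S'] (f : S →+* S')
    (c : ExponentOfDegree τ T → MvPolynomial τ S) :
    f (coeffDet c) = coeffDet fun β => map f (c β) := by
  classical
  rw [coeffDet, coeffDet, RingHom.map_det]
  congr 1

theorem coeffDet_monomial :
    coeffDet (fun β : ExponentOfDegree τ T => (monomial β.1 1 : MvPolynomial τ S)) = 1 := by
  classical
  rw [coeffDet, ← Matrix.det_one (n := ExponentOfDegree τ T)]
  congr 1
  ext β β'
  simp [coeff_monomial, Matrix.one_apply, Subtype.ext_iff, eq_comm]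

/-- Evaluating all monomials of degree `T` at a common zero gives a nonzero vector in the left
kernel of the coefficient matrix. -/
theorem coeffDet_eq_zero [Nontrivial S] [NoZeroDivisors S]
    {c : ExponentOfDegree τ T → MvPolynomial τ S}
    (hc : ∀ β, (c β).IsHomogeneous T) {x : τ → S} (hx : x ≠ 0) (h : ∀ β, eval x (c β) = 0) :
    coeffDet c = 0 := by
  classical
  have : Fintype τ := Fintype.ofFinite τ
  have : IsDomain S := { }
  rw [coeffDet, ← Matrix.exists_vecMul_eq_zero_iff]
  refine ⟨fun β => ∏ i, x i ^ β.1 i, fun h0 => ?_, ?_⟩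
  · obtain ⟨i, hi⟩ := Function.ne_iff.mp hx
    have h1 := congrFun h0 ⟨Finsupp.single i T, by simp⟩
    simp only [Pi.zero_apply] at h1
    rw [Finset.prod_eq_single i (fun j _ hj => by simp [hj.symm])
      (by simp)] at h1
    exact pow_ne_zero _ hi h1
  · ext β'
    rw [Pi.zero_apply, ← h β', eval_eq']
    simp only [Matrix.vecMul, dotProduct, Matrix.of_apply]
    symm
    rw [← Finset.sum_subtype (p := fun β : τ →₀ ℕ => β.degree = T)
      ((Finset.univ : Finset (ExponentOfDegree τ T)).map (Function.Embedding.subtype _))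
      (by simp) (fun β : τ →₀ ℕ => (∏ i, x i ^ β i) * coeff β (c β'))]
    · simp only [mul_comm]
      refine Finset.sum_subset (fun β hβ => ?_) fun β _ hβ => ?_
      · simpa using (hc β').degree_eq_of_mem_support hβ
      · rw [notMem_support_iff.mp hβ, zero_mul]

end coeffDet

theorem map_eval_map_C {υ τ : Type*} (a : υ → ℂ) (p : MvPolynomial τ ℂ) :
    map (eval a) (map C p) = p := by
  have : (eval a).comp (C : ℂ →+* MvPolynomial υ ℂ) = RingHom.id ℂ := by
    ext; simp
  rw [map_map, this, map_id]

/-- Having no common nontrivial zero is an open condition on the parameters of a family of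
systems of forms. At the given parameter `a₀`, the Nullstellensatz writes all monomials of some
degree `t` as combinations of the forms; with the same coefficients, the determinant `μ` of these
combinations takes the value `1` at `a₀`. -/
theorem exists_eval_ne_zero_of_forall_eval_map_eq_zero {υ τ ι : Type*} [Finite τ] [Fintype ι]
    {H : ι → MvPolynomial τ (MvPolynomial υ ℂ)} {d : ι → ℕ}
    (hH : ∀ i, (H i).IsHomogeneous (d i)) {a₀ : υ → ℂ}
    (h0 : ∀ v : τ → ℂ, (∀ i, eval v (map (eval a₀) (H i)) = 0) → v = 0) :
    ∃ μ : MvPolynomial υ ℂ, eval a₀ μ ≠ 0 ∧ ∀ (a : υ → ℂ) (v : τ → ℂ), v ≠ 0 →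
      (∀ i, eval v (map (eval a) (H i)) = 0) → eval a μ = 0 := by
  obtain ⟨t, ht⟩ : ∃ t, idealOfVars τ ℂ ^ t ≤
      Ideal.span (Set.range fun i => map (eval a₀) (H i)) :=
    exists_pow_idealOfVars_le fun v hv => h0 v fun i => hv _ (Ideal.subset_span ⟨i, rfl⟩)
  have hex : ∀ β : ExponentOfDegree τ t, ∃ c : ι → MvPolynomial τ ℂ,
      (∀ i, (c i).IsHomogeneous (t - d i)) ∧ (∀ i, t < d i → c i = 0) ∧
        monomial β.1 1 = ∑ i, c i * map (eval a₀) (H i) := by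
    intro β
    have hβ : (monomial β.1 (1 : ℂ)).IsHomogeneous t := isHomogeneous_monomial _ β.2
    obtain ⟨j, hj, c, h1, h2, h3⟩ := hβ.exists_eq_add_sum (J := ⊥)
      (fun p hp n => by rw [Ideal.mem_bot.mp hp, map_zero]; exact Ideal.zero_mem _)
      (fun i => (hH i).map (eval a₀))
      (Ideal.mem_sup_right (ht (hβ.mem_pow_idealOfVars le_rfl)))
    rw [Ideal.mem_bot.mp hj, zero_add] at h3
    exact ⟨c, h1, h2, h3⟩
  choose c hc hc0 hcm using hex
  set b : ExponentOfDegree τ t → MvPolynomial τ (MvPolynomial υ ℂ) := fun β =>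
    ∑ i, map C (c β i) * H i with hb
  have hbe : ∀ a β, map (eval a) (b β) = ∑ i, c β i * map (eval a) (H i) := by
    intro a β
    simp only [hb, map_sum, map_mul, map_eval_map_C]
  refine ⟨coeffDet b, ?_, fun a v hv h => ?_⟩
  · rw [map_coeffDet]
    simp only [hbe, ← hcm, coeffDet_monomial]
    exact one_ne_zero
  · rw [map_coeffDet]
    refine coeffDet_eq_zero (fun β => ?_) hv fun β => ?_
    · rw [hbe]
      refine IsHomogeneous.sum _ _ _ fun i _ => ?_
      rcases lt_or_ge t (d i) with hi | hi
      · rw [hc0 β i hi, zero_mul]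
        exact isHomogeneous_zero _ _ _
      · have := (hc β i).mul ((hH i).map (eval a))
        rwa [Nat.sub_add_cancel hi] at this
    · rw [hbe, map_sum]
      exact Finset.sum_eq_zero fun i _ => by rw [map_mul, h i, mul_zero]

end MvPolynomial

/-! ### Prime ideals that contract to zero -/

/-- Gauss's lemma: a prime ideal of `D[X]`, for `D` factorial, that meets `D` only in `0` is
principal, because it is the contraction of an ideal of `K[X]`, where `K` is the fraction field. -/
theorem Polynomial.exists_mem_forall_dvd_of_isPrime {D : Type*} [CommRing D] [IsDomain D]
    [UniqueFactorizationMonoid D] {P : Ideal (Polynomial D)} (hP : P.IsPrime)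
    (h : ∀ a : D, Polynomial.C a ∈ P → a = 0) : ∃ R ∈ P, ∀ q ∈ P, R ∣ q := by
  classical
  by_cases hbot : P = ⊥
  · exact ⟨0, P.zero_mem, fun q hq => by rw [hbot, Ideal.mem_bot] at hq; simp [hq]⟩
  obtain ⟨R, hRP, hR⟩ := hP.exists_mem_prime_of_ne_bot hbot
  have hdeg : R.natDegree ≠ 0 := fun h0 => by
    rw [Polynomial.eq_C_of_natDegree_eq_zero h0] at hRP
    exact hR.ne_zero (by rw [Polynomial.eq_C_of_natDegree_eq_zero h0, h _ hRP, map_zero])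
  refine ⟨R, hRP, fun q hq => ?_⟩
  let _ : NormalizedGCDMonoid D := Nonempty.some inferInstance
  have hprim : R.IsPrimitive := hR.irreducible.isPrimitive hdeg
  let K := FractionRing D
  have hirr : Irreducible (R.map (algebraMap D K)) :=
    hprim.irreducible_iff_irreducible_map_fraction_map.mp hR.irreducible
  by_contra hdvd
  have hcop : IsCoprime (R.map (algebraMap D K)) (q.map (algebraMap D K)) :=
    hirr.coprime_iff_not_dvd.mpr fun hd => hdvd <|
      hprim.dvd_of_fraction_map_dvd_fraction_map hd
  obtain ⟨a, b, hab⟩ := hcop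
  -- Clearing denominators in the Bézout relation gives a nonzero constant in `P`.
  obtain ⟨s, hs, hs'⟩ := IsLocalization.integerNormalization_spec (nonZeroDivisors D) a
  obtain ⟨t, ht, ht'⟩ := IsLocalization.integerNormalization_spec (nonZeroDivisors D) b
  have hst : Polynomial.C (s * t) ∈ P := by
    have : Polynomial.C (s * t) =
        Polynomial.C t * IsLocalization.integerNormalization (nonZeroDivisors D) a * R +
        Polynomial.C s * IsLocalization.integerNormalization (nonZeroDivisors D) b * q := by
      apply Polynomial.map_injective (algebraMap D K) (IsFractionRing.injective D K)
      simp only [Polynomial.map_add, Polynomial.map_mul, hs', ht', Polynomial.map_C,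
        Algebra.smul_def, Polynomial.algebraMap_apply, map_mul]
      linear_combination (-1 : Polynomial K) * Polynomial.C (algebraMap D K s) *
        Polynomial.C (algebraMap D K t) * hab
    rw [this]
    exact P.add_mem (P.mul_mem_left _ hRP) (P.mul_mem_left _ hq)
  exact mul_ne_zero (nonZeroDivisors.ne_zero hs) (nonZeroDivisors.ne_zero ht) (h _ hst)

theorem MvPolynomial.exists_mem_forall_dvd_of_isPrime {υ : Type*} {P : Ideal (MvPolynomial υ ℂ)}
    (hP : P.IsPrime) (u₀ : υ)
    (h : ∀ q : MvPolynomial {u // u ≠ u₀} ℂ, rename Subtype.val q ∈ P → q = 0) :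
    ∃ R ∈ P, ∀ q ∈ P, R ∣ q := by
  classical
  let Φ : MvPolynomial υ ℂ ≃ₐ[ℂ] Polynomial (MvPolynomial {u // u ≠ u₀} ℂ) :=
    (renameEquiv ℂ (Equiv.optionSubtypeNe u₀).symm).trans (optionEquivLeft ℂ _)
  have hΦ : ∀ q : MvPolynomial {u // u ≠ u₀} ℂ, Φ (rename Subtype.val q) = Polynomial.C q := by
    intro q
    have : (Φ : MvPolynomial υ ℂ →ₐ[ℂ] _).comp (rename Subtype.val) =
        (Polynomial.CAlgHom : MvPolynomial {u // u ≠ u₀} ℂ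
          →ₐ[MvPolynomial {u // u ≠ u₀} ℂ] _).restrictScalars ℂ := by
      refine algHom_ext fun u => ?_
      simp [Φ, Equiv.optionSubtypeNe_symm_of_ne u.2]
    exact DFunLike.congr_fun this q
  obtain ⟨R, hR, hdvd⟩ := Polynomial.exists_mem_forall_dvd_of_isPrime
    (hP.comap (Φ.symm : _ →ₐ[ℂ] MvPolynomial υ ℂ)) fun a ha => h a (by
      have := Ideal.mem_comap.mp ha
      rw [← hΦ] at this
      simpa using this)
  refine ⟨Φ.symm R, hR, fun q hq => ?_⟩
  have := map_dvd Φ.symm (hdvd (Φ q) (by simpa [Ideal.mem_comap] using hq))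
  simpa using this

/-! ### Degrees in the rows of a matrix of variables -/

namespace MvPolynomial

section RowScaling

variable {κ ι : Type*} [DecidableEq κ]

/-- Multiplication of the variables in row `a` of a `κ × ι` matrix of variables by a new variable.
The degree of the image in the new variable is the degree in row `a`. -/
noncomputable def scaleRow (a : κ) :
    MvPolynomial (κ × ι) ℂ →ₐ[ℂ] Polynomial (MvPolynomial (κ × ι) ℂ) :=
  aeval fun u => if u.1 = a then Polynomial.C (X u) * Polynomial.X else Polynomial.C (X u)

theorem scaleRow_injective (a : κ) : Function.Injective (scaleRow (ι := ι) a) := by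
  have h : (Polynomial.evalRingHom (1 : MvPolynomial (κ × ι) ℂ)).comp
      (scaleRow (ι := ι) a).toRingHom = RingHom.id _ := by
    refine ringHom_ext (fun r => ?_) fun u => ?_
    · simp [scaleRow]
    · by_cases hu : u.1 = a <;> simp [scaleRow, hu]
  exact Function.LeftInverse.injective fun p => RingHom.congr_fun h p

variable [Fintype κ] [Fintype ι]

theorem scaleRow_monomial (a : κ) (u : κ × ι →₀ ℕ) (r : ℂ) :
    scaleRow a (monomial u r) =
      Polynomial.C (monomial u r) * Polynomial.X ^ ∑ j, u (a, j) := by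
  have h1 : ∀ v : κ × ι, (if v.1 = a then Polynomial.C (X v) * Polynomial.X
      else Polynomial.C (X v) : Polynomial (MvPolynomial (κ × ι) ℂ)) =
      Polynomial.C (X v) * Polynomial.X ^ (if v.1 = a then 1 else 0) := fun v => by
    split_ifs <;> simp
  have h2 : ∏ v : κ × ι, (Polynomial.X : Polynomial (MvPolynomial (κ × ι) ℂ)) ^
      ((if v.1 = a then 1 else 0) * u v) = Polynomial.X ^ ∑ j, u (a, j) := by
    rw [Finset.prod_pow_eq_pow_sum, Fintype.sum_prod_type, Finset.sum_eq_single a]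
    · simp
    · intro b _ hb
      simp [hb]
    · simp
  rw [scaleRow, aeval_monomial, Finsupp.prod_fintype _ _ (by simp)]
  simp only [h1, mul_pow, ← pow_mul, Finset.prod_mul_distrib, h2]
  rw [monomial_eq, Finsupp.prod_fintype _ _ (by simp), map_mul, map_prod, ← mul_assoc]
  simp [IsScalarTower.algebraMap_apply ℂ (MvPolynomial (κ × ι) ℂ)
    (Polynomial (MvPolynomial (κ × ι) ℂ)), algebraMap_eq]

theorem sum_row_le_natDegree_scaleRow (a : κ) {P : MvPolynomial (κ × ι) ℂ} {u : κ × ι →₀ ℕ}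
    (hu : u ∈ P.support) : ∑ j, u (a, j) ≤ (scaleRow a P).natDegree := by
  classical
  refine Polynomial.le_natDegree_of_ne_zero fun h => mem_support_iff.mp hu ?_
  have h1 := congrArg (coeff u) h
  rw [P.as_sum, map_sum, Polynomial.finsetSum_coeff, coeff_sum] at h1
  rw [coeff_zero, Finset.sum_eq_single u] at h1
  · simpa [scaleRow_monomial, Polynomial.coeff_X_pow] using h1
  · intro v _ hv
    rw [scaleRow_monomial, Polynomial.coeff_C_mul, Polynomial.coeff_X_pow]
    split_ifs
    · simp [coeff_monomial, hv]
    · simp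
  · exact fun h => (h hu).elim

theorem totalDegree_le_sum_natDegree_scaleRow (P : MvPolynomial (κ × ι) ℂ) :
    P.totalDegree ≤ ∑ a, (scaleRow a P).natDegree := by
  refine Finset.sup_le fun u hu => ?_
  rw [Finsupp.sum_fintype _ _ (by simp), Fintype.sum_prod_type]
  exact Finset.sum_le_sum fun a _ => sum_row_le_natDegree_scaleRow a hu

end RowScaling

/-! ### The generic systems with a common zero -/

section Macaulay

variable {κ ι : Type*} [Fintype κ] [Fintype ι] (g : ι → MvPolynomial κ ℂ)

/-- The matrices `Λ` for which the system `∑ⱼ Λᵢⱼ gⱼ` has a common zero besides the origin. -/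
def degenerateSystems : Set (κ × ι → ℂ) :=
  {Λ | ∃ x : κ → ℂ, x ≠ 0 ∧ ∀ i, ∑ j, Λ (i, j) * eval x (g j) = 0}

/-- The parametrization
`(x, c, v) ↦ ((∑ₗ cₗ gₗ(x)) vᵢⱼ - (∑ₗ vᵢₗ gₗ(x)) cⱼ)` of the degenerate systems. The three summands of the index type of the variables stand for `x`, `c`
and `v`. -/
noncomputable def degenerateParam (u : κ × ι) : MvPolynomial (κ ⊕ ι ⊕ κ × ι) ℂ :=
  (∑ l, X (Sum.inr (Sum.inl l)) * rename Sum.inl (g l)) * X (Sum.inr (Sum.inr u)) -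
    (∑ l, X (Sum.inr (Sum.inr (u.1, l))) * rename Sum.inl (g l)) * X (Sum.inr (Sum.inl u.2))

/-- The ideal of the degenerate systems (see `mem_degenerateIdeal_iff`). -/
noncomputable def degenerateIdeal : Ideal (MvPolynomial (κ × ι) ℂ) :=
  RingHom.ker (aeval (degenerateParam g))

instance : (degenerateIdeal g).IsPrime := RingHom.ker_isPrime _

variable {g}

theorem mem_degenerateIdeal_iff [Nonempty κ] {d : ℕ} (hd : 0 < d)
    (hg : ∀ j, (g j).IsHomogeneous d) {e : κ → ι} (he : ∀ i, g (e i) = X i ^ d)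
    {P : MvPolynomial (κ × ι) ℂ} :
    P ∈ degenerateIdeal g ↔ ∀ Λ ∈ degenerateSystems g, eval Λ P = 0 := by
  classical
  have hev : ∀ z : κ ⊕ ι ⊕ κ × ι → ℂ, eval z (aeval (degenerateParam g) P) =
      eval (fun u => eval z (degenerateParam g u)) P := fun z => by
    simp only [← aeval_eq_eval]
    rw [← AlgHom.comp_apply, comp_aeval]
  have hpar : ∀ (x : κ → ℂ) (c : ι → ℂ) (v : κ × ι → ℂ) (u : κ × ι),
      eval (Sum.elim x (Sum.elim c v)) (degenerateParam g u) =
        (∑ l, c l * eval x (g l)) * v u - (∑ l, v (u.1, l) * eval x (g l)) * c u.2 := by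
    intro x c v u
    simp [degenerateParam, eval_rename]
  constructor
  · rintro hP Λ ⟨x, hx, h⟩
    -- `Λ` is the image of `(x, c, Λ)`, for any `c` with `∑ₗ cₗ gₗ(x) = 1`
    obtain ⟨i, hi⟩ := Function.ne_iff.mp hx
    have hgi : eval x (g (e i)) ≠ 0 := by
      rw [he]
      simpa using fun h => absurd h hi
    have h1 := hev (Sum.elim x (Sum.elim (Pi.single (e i) (eval x (g (e i)))⁻¹) Λ))
    rw [RingHom.mem_ker.mp hP, map_zero] at h1
    rw [h1]
    congr 2
    ext u
    rw [hpar, h u.1, Finset.sum_eq_single (e i) (fun l _ hl => by simp [hl]) (by simp)]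
    simp [hgi]
  · intro h
    refine RingHom.mem_ker.mpr (MvPolynomial.funext fun z => ?_)
    rw [map_zero, hev]
    refine h _ ?_
    obtain ⟨x, c, v, rfl⟩ : ∃ x c v, z = Sum.elim x (Sum.elim c v) :=
      ⟨z ∘ Sum.inl, z ∘ Sum.inr ∘ Sum.inl, z ∘ Sum.inr ∘ Sum.inr, by ext (i | i | i) <;> rfl⟩
    simp only [hpar]
    by_cases hx : x = 0
    -- the image is the zero matrix, which is degenerate
    · have hg0 : ∀ j, eval x (g j) = 0 := fun j => by
        rw [hx, eval_zero, constantCoeff_eq]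
        exact (hg j).coeff_eq_zero (by simpa using hd.ne)
      refine ⟨1, one_ne_zero, fun i => ?_⟩
      simp [hg0]
    · refine ⟨x, hx, fun i => ?_⟩
      simp only [sub_mul, Finset.sum_sub_distrib]
      simp only [mul_assoc, ← Finset.mul_sum]
      ring

end Macaulay

end MvPolynomial

/-! ### Macaulay's determinant for the generic system -/

namespace MvPolynomial

section Macaulay

variable {κ ι : Type*} [Fintype κ] [Fintype ι] {g : ι → MvPolynomial κ ℂ}

/-- Every monomial of degree `|κ| d` is divisible by some `xᵢ ^ d`. -/
theorem ExponentOfDegree.exists_le [Nonempty κ] {d : ℕ}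
    (β : ExponentOfDegree κ (Fintype.card κ * d)) : ∃ i, d ≤ β.1 i := by
  by_contra! h
  have h1 := β.2
  rw [Finsupp.degree_eq_sum] at h1
  have h2 : ∑ i, β.1 i < ∑ _i : κ, d := Finset.sum_lt_sum_of_nonempty Finset.univ_nonempty
    fun i _ => h i
  rw [Finset.sum_const, Finset.card_univ, smul_eq_mul] at h2
  omega

/-- Macaulay's determinant for the generic system `∑ⱼ λᵢⱼ gⱼ`, when `xᵢ ^ d` is among the `g`.
The column of a monomial `x ^ β` is a multiple of the equation `i`, with `d ≤ βᵢ`, and the equation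
`a` is only used if there is no other choice. This happens for `d ^ (|κ| - 1)` monomials, which
bounds the degree in row `a`. -/
theorem exists_mem_degenerateIdeal [DecidableEq κ] [Nonempty κ] {d : ℕ} (hd : 0 < d)
    (hg : ∀ j, (g j).IsHomogeneous d) {e : κ → ι} (he : ∀ i, g (e i) = X i ^ d) (a : κ)
    {E : κ × ι → ℂ} (hE : ∀ i j, E (i, j) = open Classical in if j = e i then 1 else 0) :
    ∃ Q ∈ degenerateIdeal g, eval E Q = 1 ∧
      (scaleRow a Q).natDegree ≤ d ^ (Fintype.card κ - 1) := by
  classical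
  set T := Fintype.card κ * d with hT
  have hex : ∀ β : ExponentOfDegree κ T, ∃ i, d ≤ β.1 i ∧ (i = a → ∀ l, l ≠ a → β.1 l < d) := by
    intro β
    by_cases h : ∃ l, l ≠ a ∧ d ≤ β.1 l
    · obtain ⟨l, hl, hl'⟩ := h
      exact ⟨l, hl', fun h => (hl h).elim⟩
    · push Not at h
      obtain ⟨i, hi⟩ := ExponentOfDegree.exists_le β
      exact ⟨i, hi, fun _ => h⟩
  choose ν hν hνa using hex
  set m : ExponentOfDegree κ T → MvPolynomial κ ℂ := fun β =>
    monomial (β.1 - Finsupp.single (ν β) d) 1 with hm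
  have hle : ∀ β : ExponentOfDegree κ T, Finsupp.single (ν β) d ≤ β.1 := fun β => by
    rw [Finsupp.single_le_iff]
    exact hν β
  have hmh : ∀ β j, (m β * g j).IsHomogeneous T := by
    intro β j
    have h1 : (m β).IsHomogeneous (T - d) := by
      refine isHomogeneous_monomial _ ?_
      have h2 := congrArg Finsupp.degree (tsub_add_cancel_of_le (hle β))
      rw [map_add, Finsupp.degree_single, β.2] at h2
      omega
    have h3 := h1.mul (hg j)
    rwa [Nat.sub_add_cancel (Nat.le_mul_of_pos_left d Fintype.card_pos)] at h3
  set c : ExponentOfDegree κ T → MvPolynomial κ (MvPolynomial (κ × ι) ℂ) := fun β =>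
    ∑ j, C (X (ν β, j)) * map C (m β * g j) with hc
  have hce : ∀ Λ β, map (eval Λ) (c β) = ∑ j, C (Λ (ν β, j)) * (m β * g j) := by
    intro Λ β
    simp only [hc, map_sum, map_mul _ (C _), map_eval_map_C, map_C, eval_X]
  refine ⟨coeffDet c, (mem_degenerateIdeal_iff hd hg he).mpr ?_, ?_, ?_⟩
  · rintro Λ ⟨x, hx, h⟩
    rw [map_coeffDet]
    refine coeffDet_eq_zero (fun β => ?_) hx fun β => ?_
    · rw [hce]
      exact IsHomogeneous.sum _ _ _ fun j _ => (hmh β j).C_mul _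
    · have h1 := h (ν β)
      rw [hce, map_sum]
      simp only [map_mul, eval_C, mul_left_comm _ (eval x (m β)), ← Finset.mul_sum, h1, mul_zero]
  · rw [map_coeffDet, ← coeffDet_monomial (τ := κ) (T := T)]
    congr 1
    ext1 β
    rw [hce, Finset.sum_eq_single (e (ν β)) (fun j _ hj => by simp [hE, hj]) (by simp)]
    rw [hE, if_pos rfl, he, map_one, one_mul, X_pow_eq_monomial, hm, monomial_mul,
      tsub_add_cancel_of_le (hle β), one_mul]
  · rw [coeffDet_eq_det, AlgHom.map_det, Matrix.det_apply]
    refine Polynomial.natDegree_sum_le_of_forall_le _ _ fun s _ => ?_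
    refine (Polynomial.natDegree_smul_le _ _).trans ?_
    refine (Polynomial.natDegree_prod_le _ _).trans ?_
    have hentry : ∀ β β' : ExponentOfDegree κ T,
        (scaleRow a (coeff β.1 (c β'))).natDegree ≤ if ν β' = a then 1 else 0 := by
      intro β β'
      rw [hc, coeff_sum, map_sum]
      refine Polynomial.natDegree_sum_le_of_forall_le _ _ fun j _ => ?_
      rw [coeff_C_mul, coeff_map, map_mul, ← algebraMap_eq, AlgHom.commutes]
      refine Polynomial.natDegree_mul_le.trans ?_
      rw [IsScalarTower.algebraMap_apply ℂ (MvPolynomial (κ × ι) ℂ)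
        (Polynomial (MvPolynomial (κ × ι) ℂ)), Polynomial.algebraMap_eq, Polynomial.natDegree_C,
        add_zero, scaleRow, aeval_X]
      dsimp only
      split_ifs
      · exact (Polynomial.natDegree_C_mul_le _ _).trans Polynomial.natDegree_X_le
      · exact (Polynomial.natDegree_C _).le
    refine (Finset.sum_le_sum fun β _ => hentry (s β) β).trans ?_
    rw [← Finset.card_filter]
    -- A monomial that uses the equation `a` is determined by its exponents `< d` outside `a`.
    have hinj : Fintype.card {β : ExponentOfDegree κ T // ν β = a} ≤
        Fintype.card ({l : κ // l ≠ a} → Fin d) := by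
      refine Fintype.card_le_of_injective
        (fun β l => ⟨β.1.1 l.1, hνa β.1 β.2 l.1 l.2⟩) fun β γ h => ?_
      have h1 : ∀ l, l ≠ a → β.1.1 l = γ.1.1 l := fun l hl => by
        simpa using congrFun h ⟨l, hl⟩
      refine Subtype.ext (Subtype.ext (Finsupp.ext fun l => ?_))
      by_cases hl : l = a
      · have h2 : ∑ l, β.1.1 l = ∑ l, γ.1.1 l := by
          rw [← Finsupp.degree_eq_sum, ← Finsupp.degree_eq_sum, β.1.2, γ.1.2]
        rw [← Finset.add_sum_erase _ _ (Finset.mem_univ a),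
          ← Finset.add_sum_erase _ (fun l => γ.1.1 l) (Finset.mem_univ a),
          Finset.sum_congr rfl fun l hl => h1 l (Finset.ne_of_mem_erase hl)] at h2
        rw [hl]
        exact Nat.add_right_cancel h2
      · exact h1 l hl
    rw [Fintype.card_subtype] at hinj
    simpa using hinj

end Macaulay

end MvPolynomial

/-! ### The resultant -/

namespace MvPolynomial

section Resultant

variable {κ ι : Type} [Fintype κ] [Fintype ι] {g : ι → MvPolynomial κ ℂ}

/-- Fix all the entries of `Λ` but the one at `(a, e a)`, the coefficient of `x_a ^ d` in the
equation `a`. For a generic choice, the other equations have a common zero `x` with `x_a ≠ 0`, and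
the remaining entry can be chosen such that `x` solves the equation `a` too. -/
theorem eq_zero_of_rename_mem_degenerateIdeal [Nonempty κ] {d : ℕ} (hd : 0 < d)
    (hg : ∀ j, (g j).IsHomogeneous d) {e : κ → ι} (he : ∀ i, g (e i) = X i ^ d) (a : κ)
    {q : MvPolynomial {u : κ × ι // u ≠ (a, e a)} ℂ}
    (hq : rename Subtype.val q ∈ degenerateIdeal g) : q = 0 := by
  classical
  by_contra hq0
  set E : κ × ι → ℂ := fun u => if u.2 = e u.1 then 1 else 0 with hE
  obtain ⟨Q, hQ, hQE, -⟩ := exists_mem_degenerateIdeal hd hg he a (E := E)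
    (fun i j => by simp [hE])
  set q' : MvPolynomial (κ × ι) ℂ := rename Subtype.val q with hq'
  have hq'0 : q' ≠ 0 := 
    (map_ne_zero_iff _ (rename_injective _ Subtype.val_injective)).mpr hq0
  -- `Q` with its row `a` specialized to that of `E`
  set Q' : MvPolynomial (κ × ι) ℂ := aeval (fun u => if u.1 = a then C (E u) else X u) Q with hQ'
  have hQ'e : ∀ Λ, eval Λ Q' = eval (fun u => if u.1 = a then E u else Λ u) Q := by
    intro Λ
    rw [hQ', ← aeval_eq_eval, ← aeval_eq_eval, ← AlgHom.comp_apply, comp_aeval]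
    congr 2
    ext u
    split_ifs <;> simp
  have hQ'0 : Q' ≠ 0 := fun h => by
    have h1 := hQ'e E
    simp [h, hQE] at h1
  obtain ⟨Λ, hΛ⟩ : ∃ Λ, eval Λ (q' * Q') ≠ 0 := by
    by_contra! h
    exact mul_ne_zero hq'0 hQ'0 (MvPolynomial.funext fun Λ => by rw [h, map_zero])
  rw [map_mul, hQ'e] at hΛ
  obtain ⟨x, hx, hxe⟩ : ∃ x : κ → ℂ, x ≠ 0 ∧
      ∀ i : {i // i ≠ a}, ∑ j, Λ (i.1, j) * eval x (g j) = 0 := by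
    by_contra! h
    have h1 := card_le_card_of_forall_eval_eq_zero (σ := κ) (ι := {i // i ≠ a})
      (y := fun i => ∑ j, C (Λ (i.1, j)) * g j) (d := fun _ => d)
      (fun i => IsHomogeneous.sum _ _ _ fun j _ => (hg j).C_mul _) (fun _ => hd) fun v hv => by
        by_contra hv0
        obtain ⟨i, hi⟩ := h v hv0
        exact hi (by simpa using hv i)
    have h2 : 0 < Fintype.card κ := Fintype.card_pos
    simp at h1
    omega
  have hxa : x a ≠ 0 := by
    intro hxa
    refine right_ne_zero_of_mul hΛ ((mem_degenerateIdeal_iff hd hg he).mp hQ _ ⟨x, hx, fun i => ?_⟩)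
    by_cases hi : i = a
    · subst hi
      simp [hE, he, hxa, hd.ne']
    · simpa [hi] using hxe ⟨i, hi⟩
  refine left_ne_zero_of_mul hΛ ?_
  set Λ' : κ × ι → ℂ := Function.update Λ (a, e a)
    (-(∑ j ∈ Finset.univ.erase (e a), Λ (a, j) * eval x (g j)) / x a ^ d) with hΛ'
  have h1 : eval Λ' q' = eval Λ q' := by
    rw [hq', eval_rename, eval_rename]
    congr 2
    ext u
    simp [hΛ', Function.update_of_ne u.2]
  rw [← h1]
  refine (mem_degenerateIdeal_iff hd hg he).mp hq _ ⟨x, hx, fun i => ?_⟩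
  by_cases hi : i = a
  · subst hi
    rw [← Finset.add_sum_erase _ _ (Finset.mem_univ (e i)),
      Finset.sum_congr rfl fun j hj => by
        rw [hΛ', Function.update_of_ne (by simpa using Finset.ne_of_mem_erase hj)]]
    rw [hΛ', Function.update_self, he]
    simp only [map_pow, eval_X]
    field_simp
    ring
  · rw [← hxe ⟨i, hi⟩]
    refine Finset.sum_congr rfl fun j _ => ?_
    rw [hΛ', Function.update_of_ne (by simp [hi])]

/-- The resultant of the systems `∑ⱼ Λᵢⱼ gⱼ`, when every `xᵢ ^ d` is among the `g`: the generator
of the ideal of the degenerate systems. It divides every Macaulay determinant, so its degree in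
each row is at most `d ^ (|κ| - 1)`. -/
theorem exists_resultant_of_X_pow [Nonempty κ] {d : ℕ} (hd : 0 < d)
    (hg : ∀ j, (g j).IsHomogeneous d) {e : κ → ι} (he : ∀ i, g (e i) = X i ^ d) :
    ∃ R : MvPolynomial (κ × ι) ℂ, R.totalDegree ≤ Fintype.card κ * d ^ (Fintype.card κ - 1) ∧
      ∀ Λ, eval Λ R = 0 ↔ Λ ∈ degenerateSystems g := by
  classical
  let a₀ : κ := Classical.arbitrary κ
  obtain ⟨R, hR, hdvd⟩ := exists_mem_forall_dvd_of_isPrime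
    (inferInstance : (degenerateIdeal g).IsPrime) (a₀, e a₀)
    fun q => eq_zero_of_rename_mem_degenerateIdeal hd hg he a₀
  refine ⟨R, ?_, fun Λ => ⟨fun h => ?_, (mem_degenerateIdeal_iff hd hg he).mp hR Λ⟩⟩
  · refine (totalDegree_le_sum_natDegree_scaleRow R).trans ?_
    rw [← smul_eq_mul, ← Finset.card_univ, ← Finset.sum_const]
    refine Finset.sum_le_sum fun a _ => ?_
    obtain ⟨Q, hQ, hQE, hQd⟩ := exists_mem_degenerateIdeal hd hg he a
      (E := fun u => if u.2 = e u.1 then 1 else 0) (fun i j => by simp)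
    have hQ0 : Q ≠ 0 := fun h => by simp [h] at hQE
    exact (Polynomial.natDegree_le_of_dvd (map_dvd (scaleRow a) (hdvd Q hQ))
      ((map_ne_zero_iff _ (scaleRow_injective a)).mpr hQ0)).trans hQd
  · by_contra hΛ
    obtain ⟨μ, hμ, hμ0⟩ := exists_eval_ne_zero_of_forall_eval_map_eq_zero
      (H := fun i : κ => ∑ j, C (X (i, j) : MvPolynomial (κ × ι) ℂ) * map C (g j))
      (d := fun _ => d) (a₀ := Λ)
      (fun i => IsHomogeneous.sum _ _ _ fun j _ => ((hg j).map C).C_mul _) fun v hv => by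
        by_contra hv0
        refine hΛ ⟨v, hv0, fun i => ?_⟩
        have := hv i
        simpa [map_eval_map_C] using this
    -- `μ` is a multiple of `R`, but does not vanish at `Λ`
    have h1 : μ ∈ degenerateIdeal g := by
      refine (mem_degenerateIdeal_iff hd hg he).mpr ?_
      rintro Λ' ⟨x, hx, h⟩
      exact hμ0 Λ' x hx fun i => by simpa [map_eval_map_C] using h i
    obtain ⟨s, rfl⟩ := hdvd μ h1
    exact hμ (by rw [map_mul, h, zero_mul])

end Resultant

theorem totalDegree_aeval_le {υ υ' : Type*} {φ : υ → MvPolynomial υ' ℂ}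
    (hφ : ∀ u, (φ u).totalDegree ≤ 1) (P : MvPolynomial υ ℂ) :
    (aeval φ P).totalDegree ≤ P.totalDegree := by
  rw [aeval_def, eval₂_eq]
  refine totalDegree_finsetSum_le fun u hu => ?_
  refine (totalDegree_mul _ _).trans ?_
  rw [algebraMap_eq, totalDegree_C, zero_add]
  refine (totalDegree_finsetProd _ _).trans ?_
  refine le_trans (Finset.sum_le_sum fun i _ => ?_) (le_totalDegree hu)
  exact (totalDegree_pow _ _).trans ((Nat.mul_le_mul_left _ (hφ i)).trans (mul_one _).le)

end MvPolynomial

/-! ### The Chow form of a system without common zeros -/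

namespace MvPolynomial

theorem IsHomogeneous.eval_smul {τ R : Type*} [Finite τ] [CommRing R] {p : MvPolynomial τ R} {d : ℕ}
    (hp : p.IsHomogeneous d) (s : R) (x : τ → R) : eval (s • x) p = s ^ d * eval x p := by
  have : Fintype τ := Fintype.ofFinite τ
  rw [eval_eq', eval_eq', Finset.mul_sum]
  refine Finset.sum_congr rfl fun u hu => ?_
  simp only [Pi.smul_apply, smul_eq_mul, mul_pow, Finset.prod_mul_distrib,
    Finset.prod_pow_eq_pow_sum, ← Finsupp.degree_eq_sum, hp.degree_eq_of_mem_support hu]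
  ring

/-- Forms of the same degree without common nontrivial zeros have as many linear combinations as
there are variables with the same property. As long as there are more forms than variables, they
are algebraically dependent, so the closed cone of their values is not the whole space, and the
projection from a line outside this cone reduces their number by one. -/
theorem exists_linear_combinations {κ : Type} [Fintype κ] {d : ℕ} (hd : 0 < d) :
    ∀ {m : ℕ} {g : Fin m → MvPolynomial κ ℂ}, (∀ j, (g j).IsHomogeneous d) →
      (∀ x : κ → ℂ, (∀ j, eval x (g j) = 0) → x = 0) →
      ∃ Λ : κ × Fin m → ℂ, ∀ x : κ → ℂ, (∀ i, ∑ j, Λ (i, j) * eval x (g j) = 0) → x = 0 := by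
  classical
  intro m
  induction m with
  | zero => exact fun {g} _ h0 => ⟨0, fun x _ => h0 x fun j => j.elim0⟩
  | succ m ih =>
    intro g hg h0
    by_cases hm : m + 1 ≤ Fintype.card κ
    · obtain ⟨f⟩ := Function.Embedding.nonempty_of_card_le (α := Fin (m + 1)) (β := κ)
        (by simpa using hm)
      refine ⟨fun u => if u.1 = f u.2 then 1 else 0, fun x hx => h0 x fun j => ?_⟩
      simpa using hx (f j)
    have hdep : ¬ AlgebraicIndependent ℂ g := fun h => by
      have h1 := h.cardinalMk_le_trdeg
      rw [MvPolynomial.trdeg_of_isDomain] at h1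
      exact hm (by simpa using h1)
    rw [algebraicIndependent_iff_injective_aeval, injective_iff_map_eq_zero] at hdep
    push Not at hdep
    obtain ⟨q, hq, hq0⟩ := hdep
    obtain ⟨c, hc⟩ : ∃ c, eval c (q * X (Fin.last m)) ≠ 0 := by
      by_contra! h
      exact mul_ne_zero hq0 (X_ne_zero _) (MvPolynomial.funext fun c => by rw [h, map_zero])
    rw [map_mul, eval_X] at hc
    have hcq := left_ne_zero_of_mul hc
    have hcl := right_ne_zero_of_mul hc
    -- no value of `g` is a nonzero multiple of `c`
    have hcone : ∀ (x : κ → ℂ) (t : ℂ), (∀ j, eval x (g j) = t * c j) → x = 0 := by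
      intro x t hx
      by_cases ht : t = 0
      · exact h0 x fun j => by rw [hx, ht, zero_mul]
      · obtain ⟨s, hs⟩ := IsAlgClosed.exists_pow_nat_eq t⁻¹ hd
        refine (hcq ?_).elim
        have h1 : c = fun j => eval (s • x) (g j) := by
          ext j
          rw [(hg j).eval_smul, hs, hx, inv_mul_cancel_left₀ ht]
        have h2 := congrArg (eval (s • x)) hq
        rw [← aeval_eq_eval, ← AlgHom.comp_apply, comp_aeval, map_zero] at h2
        rw [h1, ← aeval_eq_eval]
        exact h2
    obtain ⟨Λ, hΛ⟩ := ih (g := fun j => g j.castSucc - C (c j.castSucc / c (Fin.last m)) *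
        g (Fin.last m)) (fun j => (hg _).sub ((hg _).C_mul _)) fun x hx => by
      refine hcone x (eval x (g (Fin.last m)) / c (Fin.last m)) fun j => ?_
      refine Fin.lastCases ?_ (fun j => ?_) j
      · field_simp
      · have := hx j
        simp only [map_sub, map_mul, eval_C, sub_eq_zero] at this
        rw [this]
        ring
    refine ⟨fun u => Fin.lastCases (motive := fun _ => ℂ)
      (-∑ j, Λ (u.1, j) * (c j.castSucc / c (Fin.last m))) (fun j => Λ (u.1, j)) u.2,
      fun x hx => hΛ x fun i => ?_⟩
    rw [← hx i, Fin.sum_univ_castSucc]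
    simp only [Fin.lastCases_castSucc, Fin.lastCases_last, map_sub, map_mul, eval_C, mul_sub,
      Finset.sum_sub_distrib, neg_mul, Finset.sum_mul, ← sub_eq_add_neg, mul_assoc]

/-- Up to multiplicities, the Chow form of the image of `g : ℙ^(|κ| - 1) → ℙ^(m - 1)`: a nonzero
polynomial that vanishes at the matrices `Λ` for which the system `∑ⱼ Λᵢⱼ gⱼ` has a common zero
besides the origin. It is a specialization of the resultant of the systems of combinations of the
`g` and the `xᵢ ^ d`. -/
theorem exists_chowForm {κ : Type} [Fintype κ] [Nonempty κ] {d m : ℕ} (hd : 0 < d)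
    {g : Fin m → MvPolynomial κ ℂ} (hg : ∀ j, (g j).IsHomogeneous d)
    (h0 : ∀ x : κ → ℂ, (∀ j, eval x (g j) = 0) → x = 0) :
    ∃ R : MvPolynomial (κ × Fin m) ℂ, R ≠ 0 ∧
      R.totalDegree ≤ Fintype.card κ * d ^ (Fintype.card κ - 1) ∧
      ∀ Λ, eval Λ R ≠ 0 → ∀ x : κ → ℂ, (∀ i, ∑ j, Λ (i, j) * eval x (g j) = 0) → x = 0 := by
  obtain ⟨R, hRd, hR⟩ := exists_resultant_of_X_pow (ι := κ ⊕ Fin m)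
    (g := Sum.elim (fun i => X i ^ d) g) (e := Sum.inl) hd
    (by
      rintro (i | j)
      exacts [isHomogeneous_X_pow i d, hg j]) fun _ => rfl
  set φ : κ × (κ ⊕ Fin m) → MvPolynomial (κ × Fin m) ℂ := fun u =>
    Sum.elim (fun _ => 0) (fun j => X (u.1, j)) u.2 with hφ
  have hev : ∀ Λ, eval Λ (aeval φ R) = 0 ↔
      ∃ x : κ → ℂ, x ≠ 0 ∧ ∀ i, ∑ j, Λ (i, j) * eval x (g j) = 0 := by
    intro Λ
    rw [← aeval_eq_eval, ← AlgHom.comp_apply, comp_aeval, aeval_eq_eval, hR]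
    simp [degenerateSystems, hφ]
  refine ⟨aeval φ R, fun h => ?_, (totalDegree_aeval_le ?_ R).trans hRd, fun Λ hΛ x hx => ?_⟩
  · obtain ⟨Λ, hΛ⟩ := exists_linear_combinations hd hg h0
    obtain ⟨x, hx, hx'⟩ := (hev Λ).mp (by rw [h, map_zero])
    exact hx (hΛ x hx')
  · rintro ⟨i, j | j⟩ <;> simp [hφ]
  · by_contra hx0
    exact hΛ ((hev Λ).mpr ⟨x, hx0, hx⟩)

end MvPolynomial

/-! ### Projective varieties and homogeneous primes -/

theorem isProjVariety_projZeroLocus {n : ℕ} {ι : Type*} [Finite ι]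
    {F : ι → MvPolynomial (Fin (n + 1)) ℂ} (hF : ∀ i, ∃ e, (F i).IsHomogeneous e) :
    IsProjVariety (projZeroLocus F) := by
  obtain ⟨k, ⟨f⟩⟩ := Finite.exists_equiv_fin ι
  refine ⟨k, F ∘ f.symm, fun i => hF _, ?_⟩
  ext p
  exact (f.symm.forall_congr_right (q := fun i => MvPolynomial.eval p.rep (F i) = 0)).symm

theorem IsProjVariety.inter {n : ℕ} {X Y : Set (CProj n)} (hX : IsProjVariety X)
    (hY : IsProjVariety Y) : IsProjVariety (X ∩ Y) := by
  obtain ⟨k, F, hF, rfl⟩ := hX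
  obtain ⟨l, G, hG, rfl⟩ := hY
  have h : projZeroLocus F ∩ projZeroLocus G = projZeroLocus (Sum.elim F G) := by
    ext p
    simp [projZeroLocus]
  rw [h]
  exact isProjVariety_projZeroLocus (by rintro (i | i); exacts [hF i, hG i])

theorem IsProjVariety.union {n : ℕ} {X Y : Set (CProj n)} (hX : IsProjVariety X)
    (hY : IsProjVariety Y) : IsProjVariety (X ∪ Y) := by
  obtain ⟨k, F, hF, rfl⟩ := hX
  obtain ⟨l, G, hG, rfl⟩ := hY
  have h : projZeroLocus F ∪ projZeroLocus G =
      projZeroLocus fun u : Fin k × Fin l => F u.1 * G u.2 := by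
    ext p
    refine ⟨?_, fun hp => ?_⟩
    · rintro (hp | hp) u
      · rw [map_mul, hp u.1, zero_mul]
      · rw [map_mul, hp u.2, mul_zero]
    · by_contra hcon
      rw [Set.mem_union, not_or] at hcon
      simp only [projZeroLocus, Set.mem_ofPred_eq, not_forall] at hcon
      obtain ⟨⟨i, hi⟩, j, hj⟩ := hcon
      exact mul_ne_zero hi hj (by simpa using hp (i, j))
  rw [h]
  refine isProjVariety_projZeroLocus fun u => ?_
  obtain ⟨a, ha⟩ := hF u.1
  obtain ⟨b, hb⟩ := hG u.2
  exact ⟨a + b, ha.mul hb⟩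

theorem isProjVariety_empty {n : ℕ} : IsProjVariety (∅ : Set (CProj n)) := by
  have h : (∅ : Set (CProj n)) = projZeroLocus fun _ : Fin 1 => 1 := by
    ext p
    simp [projZeroLocus]
  rw [h]
  exact isProjVariety_projZeroLocus fun _ => ⟨0, MvPolynomial.isHomogeneous_one _ _⟩

theorem IsProjVariety.biUnion {n : ℕ} {α : Type*} (S : Finset α) {Z : α → Set (CProj n)}
    (hZ : ∀ a ∈ S, IsProjVariety (Z a)) : IsProjVariety (⋃ a ∈ S, Z a) := by
  classical
  induction S using Finset.induction_on with
  | empty => simpa using isProjVariety_empty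
  | insert a S _ ih =>
    rw [Finset.set_biUnion_insert]
    exact (hZ a (Finset.mem_insert_self _ _)).union
      (ih fun b hb => hZ b (Finset.mem_insert_of_mem hb))

theorem IsIrreducibleVariety.exists_subset {n : ℕ} {α : Type*} {X : Set (CProj n)}
    (hX : IsIrreducibleVariety X) (S : Finset α) {Z : α → Set (CProj n)}
    (hZ : ∀ a ∈ S, IsProjVariety (Z a)) (hXZ : X ⊆ ⋃ a ∈ S, Z a) : ∃ a ∈ S, X ⊆ Z a := by
  classical
  induction S using Finset.induction_on with
  | empty =>
    obtain ⟨p, hp⟩ := hX.2.1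
    simpa using hXZ hp
  | insert a S _ ih =>
    have hZS : ∀ b ∈ S, IsProjVariety (Z b) := fun b hb => hZ b (Finset.mem_insert_of_mem hb)
    rw [Finset.set_biUnion_insert] at hXZ
    rcases hX.2.2 (X ∩ Z a) (X ∩ ⋃ b ∈ S, Z b)
      (hX.1.inter (hZ a (Finset.mem_insert_self _ _))) (hX.1.inter (.biUnion S hZS))
      (by rw [← Set.inter_union_distrib_left, Set.inter_eq_left.mpr hXZ]) with h | h
    · exact ⟨a, Finset.mem_insert_self _ _, Set.inter_eq_left.mp h.symm⟩
    · obtain ⟨b, hb, hb'⟩ := ih hZS (Set.inter_eq_left.mp h.symm)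
      exact ⟨b, Finset.mem_insert_of_mem hb, hb'⟩

/-- The projective zero locus of an ideal. It is only used for homogeneous ideals. -/
def idealLocus {n : ℕ} (I : Ideal (MvPolynomial (Fin (n + 1)) ℂ)) : Set (CProj n) :=
  {p | ∀ q ∈ I, MvPolynomial.eval p.rep q = 0}

open MvPolynomial

theorem mk_mem_idealLocus {n : ℕ} {I : Ideal (MvPolynomial (Fin (n + 1)) ℂ)}
    (hI : ∀ p ∈ I, ∀ e, homogeneousComponent e p ∈ I) (v : Fin (n + 1) → ℂ) (hv : v ≠ 0)
    (h : ∀ q ∈ I, eval v q = 0) : Projectivization.mk ℂ v hv ∈ idealLocus I := by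
  intro q hq
  obtain ⟨a, ha⟩ := Projectivization.exists_smul_eq_mk_rep ℂ v hv
  rw [← ha, Units.smul_def, ← sum_homogeneousComponent q, map_sum]
  refine Finset.sum_eq_zero fun e _ => ?_
  rw [(homogeneousComponent_isHomogeneous e q).eval_smul, h _ (hI q hq e), mul_zero]

theorem isProjVariety_idealLocus {n : ℕ} {I : Ideal (MvPolynomial (Fin (n + 1)) ℂ)}
    (hI : ∀ p ∈ I, ∀ e, homogeneousComponent e p ∈ I) : IsProjVariety (idealLocus I) := by
  obtain ⟨s, rfl⟩ := IsNoetherian.noetherian I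
  have h : idealLocus (Ideal.span (s : Set (MvPolynomial (Fin (n + 1)) ℂ))) =
      projZeroLocus fun u : (q : s) × Fin (q.1.totalDegree + 1) =>
        homogeneousComponent u.2 u.1.1 := by
    ext p
    refine ⟨fun hp u => hp _ (hI _ (Ideal.subset_span u.1.2) _), fun hp q hq => ?_⟩
    have hle : Ideal.span (s : Set (MvPolynomial (Fin (n + 1)) ℂ)) ≤
        RingHom.ker (eval p.rep) := by
      rw [Ideal.span_le]
      intro g hg
      rw [SetLike.mem_coe, RingHom.mem_ker, ← sum_homogeneousComponent g, map_sum]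
      refine Finset.sum_eq_zero fun e he => ?_
      exact hp ⟨⟨g, hg⟩, ⟨e, Finset.mem_range.mp he⟩⟩
    exact hle hq
  rw [Ideal.submodule_span_eq, h]
  exact isProjVariety_projZeroLocus fun u => ⟨_, homogeneousComponent_isHomogeneous _ _⟩

theorem isIrreducibleVariety_idealLocus {n : ℕ} {𝔮 : Ideal (MvPolynomial (Fin (n + 1)) ℂ)}
    (hp : 𝔮.IsPrime) (hI : ∀ p ∈ 𝔮, ∀ e, homogeneousComponent e p ∈ 𝔮)
    (hne : (idealLocus 𝔮).Nonempty) : IsIrreducibleVariety (idealLocus 𝔮) := by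
  refine ⟨isProjVariety_idealLocus hI, hne, ?_⟩
  have key : ∀ Y : Set (CProj n), IsProjVariety Y → Y ⊆ idealLocus 𝔮 → idealLocus 𝔮 ≠ Y →
      ∃ G : MvPolynomial (Fin (n + 1)) ℂ, (∃ e, G.IsHomogeneous e) ∧ G ∉ 𝔮 ∧
        ∀ v hv, Projectivization.mk ℂ v hv ∈ Y → eval v G = 0 := by
    rintro _ ⟨k, F, hF, rfl⟩ hsub hneq
    obtain ⟨p, hp, hp'⟩ := Set.not_subset.mp fun h => hneq (h.antisymm hsub)
    simp only [projZeroLocus, Set.mem_ofPred_eq, not_forall] at hp'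
    obtain ⟨i, hi⟩ := hp'
    exact ⟨F i, hF i, fun h => hi (hp _ h), fun v hv h => (mk_mem_projZeroLocus hF v hv).mp h i⟩
  intro Y Z hY hZ hYZ
  by_contra! hcon
  obtain ⟨G, ⟨a, hG⟩, hG𝔮, hGY⟩ := key Y hY (hYZ ▸ Set.subset_union_left) hcon.1
  obtain ⟨H, ⟨b, hH⟩, hH𝔮, hHZ⟩ := key Z hZ (hYZ ▸ Set.subset_union_right) hcon.2
  have hvan : ∀ v : Fin (n + 1) → ℂ, v ≠ 0 → (∀ q ∈ 𝔮, eval v q = 0) → eval v (G * H) = 0 := by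
    intro v hv h
    have h1 := mk_mem_idealLocus hI v hv h
    rw [hYZ] at h1
    rw [map_mul]
    rcases h1 with h1 | h1
    · rw [hGY v hv h1, zero_mul]
    · rw [hHZ v hv h1, mul_zero]
  have hmem : G * H ∈ 𝔮 := by
    rw [← IsPrime.vanishingIdeal_zeroLocus (K := ℂ) 𝔮]
    intro v hv
    rw [aeval_eq_eval]
    by_cases hv0 : v = 0
    · obtain ⟨p, hp⟩ := hne
      have h1 := (hG.mul hH).eval_smul 0 p.rep
      rwa [hvan _ p.rep_nonzero hp, mul_zero, zero_smul, ← hv0] at h1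
    · exact hvan v hv0 fun q hq => by simpa [aeval_eq_eval] using hv q hq
  exact (hp.mem_or_mem hmem).elim hG𝔮 hH𝔮

theorem homogeneousComponent_mem_of_mem_minimalPrimes {σ κ : Type*}
    {F : κ → MvPolynomial σ ℂ} (hF : ∀ i, ∃ e, (F i).IsHomogeneous e)
    {𝔮 : Ideal (MvPolynomial σ ℂ)} (h𝔮 : 𝔮 ∈ (Ideal.span (Set.range F)).minimalPrimes) :
    ∀ p ∈ 𝔮, ∀ e, homogeneousComponent e p ∈ 𝔮 := by
  let _ : GradedAlgebra (homogeneousSubmodule σ ℂ) := MvPolynomial.gradedAlgebra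
  have hle := Ideal.toIdeal_homogeneousCore_le (homogeneousSubmodule σ ℂ) 𝔮
  have h1 : 𝔮 ≤ (𝔮.homogeneousCore (homogeneousSubmodule σ ℂ)).toIdeal := by
    refine h𝔮.2 ⟨h𝔮.1.1.homogeneousCore, ?_⟩ hle
    rw [Ideal.span_le]
    rintro _ ⟨i, rfl⟩
    exact Ideal.mem_homogeneousCore_of_homogeneous_of_mem (hF i)
      (h𝔮.1.2 (Ideal.subset_span ⟨i, rfl⟩))
  have h2 : 𝔮.IsHomogeneous (homogeneousSubmodule σ ℂ) :=
    (Ideal.IsHomogeneous.iff_eq _ _).mpr (le_antisymm hle h1)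
  exact fun p hp e => homogeneousComponent_mem_of_mem h2 hp e

/-- The irreducible components of a projective variety are the zero loci of minimal primes. -/
theorem IsIrreducibleComponent.exists_minimalPrimes {n : ℕ} {κ : Type*}
    {F : κ → MvPolynomial (Fin (n + 1)) ℂ} (hF : ∀ i, ∃ e, (F i).IsHomogeneous e)
    {X : Set (CProj n)} (hX : IsIrreducibleComponent X (projZeroLocus F)) :
    ∃ 𝔮 ∈ (Ideal.span (Set.range F)).minimalPrimes, X = idealLocus 𝔮 := by
  have hfin := (Ideal.span (Set.range F)).finite_minimalPrimes_of_isNoetherianRing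
  have hhom := fun 𝔮 h𝔮 => homogeneousComponent_mem_of_mem_minimalPrimes hF (𝔮 := 𝔮) h𝔮
  obtain ⟨𝔮, h𝔮, hX𝔮⟩ := hX.1.exists_subset hfin.toFinset (Z := idealLocus)
    (fun 𝔮 h𝔮 => isProjVariety_idealLocus (hhom 𝔮 (hfin.mem_toFinset.mp h𝔮))) (by
      intro p hp
      have hle : Ideal.span (Set.range F) ≤ RingHom.ker (eval p.rep) := by
        rw [Ideal.span_le]
        rintro _ ⟨i, rfl⟩
        exact hX.2.1 hp i
      have : (RingHom.ker (eval p.rep)).IsPrime := RingHom.ker_isPrime _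
      obtain ⟨𝔮, h𝔮, hle'⟩ := Ideal.exists_minimalPrimes_le hle
      exact Set.mem_biUnion (hfin.mem_toFinset.mpr h𝔮) fun q hq => hle' hq)
  rw [hfin.mem_toFinset] at h𝔮
  refine ⟨𝔮, h𝔮, (hX.2.2 _ ?_ ?_ hX𝔮).symm⟩
  · exact isIrreducibleVariety_idealLocus h𝔮.1.1 (hhom 𝔮 h𝔮) (hX.1.2.1.mono hX𝔮)
  · exact fun p hp i => hp _ (h𝔮.1.2 (Ideal.subset_span ⟨i, rfl⟩))

/-! ### Linear subspaces and the dimension of complete intersections -/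

theorem mk_mem_projLinearSubspace {n : ℕ} {W : Submodule ℂ (Fin (n + 1) → ℂ)}
    {v : Fin (n + 1) → ℂ} (hv : v ≠ 0) :
    Projectivization.mk ℂ v hv ∈ projLinearSubspace W ↔ v ∈ W := by
  simp [projLinearSubspace, Projectivization.submodule_mk]

theorem rep_mem_of_mem_projLinearSubspace {n : ℕ} {W : Submodule ℂ (Fin (n + 1) → ℂ)}
    {p : CProj n} (hp : p ∈ projLinearSubspace W) : p.rep ∈ W := by
  rw [← p.mk_rep] at hp
  exact (mk_mem_projLinearSubspace p.rep_nonzero).mp hp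

theorem exists_linear_forms {σ : Type*} [Fintype σ] {s : ℕ} (W : Submodule ℂ (σ → ℂ))
    (hs : Module.finrank ℂ W + s = Fintype.card σ) :
    ∃ ℓ : Fin s → MvPolynomial σ ℂ, (∀ i, (ℓ i).IsHomogeneous 1) ∧
      ∀ v, (∀ i, eval v (ℓ i) = 0) ↔ v ∈ W := by
  classical
  have h1 : Module.finrank ℂ ((σ → ℂ) ⧸ W) = s := by
    have := W.finrank_quotient_add_finrank
    rw [Module.finrank_fintype_fun_eq_card] at this
    omega
  let b := (Module.finBasisOfFinrankEq ℂ ((σ → ℂ) ⧸ W) h1).equivFun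
  have hb : ∀ v i, b (W.mkQ v) i = ∑ j, b (W.mkQ (Pi.single j 1)) i * v j := by
    intro v i
    conv_lhs => rw [pi_eq_sum_univ' v]
    simp [map_sum, mul_comm]
  refine ⟨fun i => ∑ j, C (b (W.mkQ (Pi.single j 1)) i) * X j,
    fun i => IsHomogeneous.sum _ _ _ fun j _ => isHomogeneous_C_mul_X _ _, fun v => ?_⟩
  simp only [map_sum, map_mul, eval_C, eval_X, ← hb]
  have h2 : v ∈ W ↔ b (W.mkQ v) = 0 := by simp
  rw [h2, funext_iff]
  rfl

/-- The restriction of a polynomial to the span of the rows of a matrix of variables. -/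
noncomputable def genericRestrict {σ : Type*} (s : ℕ) :
    MvPolynomial σ ℂ →ₐ[ℂ] MvPolynomial (Fin s) (MvPolynomial (Fin s × σ) ℂ) :=
  aeval fun j => ∑ l, C (X (l, j)) * X l

theorem eval_map_genericRestrict {σ : Type*} {s : ℕ} (α : Fin s × σ → ℂ) (y : Fin s → ℂ)
    (p : MvPolynomial σ ℂ) :
    eval y (map (eval α) (genericRestrict s p)) = eval (fun j => ∑ l, α (l, j) * y l) p := by
  have h : ((eval y).comp (map (eval α))).comp (genericRestrict (σ := σ) s).toRingHom =
      eval (fun j => ∑ l, α (l, j) * y l) := by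
    refine ringHom_ext (fun r => ?_) fun j => ?_
    · simp [genericRestrict, IsScalarTower.algebraMap_apply ℂ (MvPolynomial (Fin s × σ) ℂ)
        (MvPolynomial (Fin s) (MvPolynomial (Fin s × σ) ℂ)), algebraMap_eq]
    · simp [genericRestrict]
  exact RingHom.congr_fun h p

theorem MvPolynomial.IsHomogeneous.genericRestrict {σ : Type*} {s d : ℕ} {p : MvPolynomial σ ℂ}
    (hp : p.IsHomogeneous d) : (genericRestrict s p).IsHomogeneous d := by
  have := hp.aeval (fun j => ∑ l : Fin s, C (X (l, j) : MvPolynomial (Fin s × σ) ℂ) * X l)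
    (n := 1) fun j => IsHomogeneous.sum _ _ _ fun l _ => isHomogeneous_C_mul_X _ _
  rwa [one_mul] at this

/-- If one linear subspace of dimension `k` (as a subspace of `ℂ^(n+1)`) is disjoint from a
projective variety, then so is the generic one of any smaller dimension. -/
theorem forGenericSubspace_disjoint {n k s : ℕ} {ι : Type*} [Fintype ι]
    {F : ι → MvPolynomial (Fin (n + 1)) ℂ} {d : ι → ℕ} (hF : ∀ i, (F i).IsHomogeneous (d i))
    {a : Fin k → Fin (n + 1) → ℂ} (ha : LinearIndependent ℂ a)
    (h0 : ∀ v ∈ Submodule.span ℂ (Set.range a), (∀ i, eval v (F i) = 0) → v = 0) (hs : s ≤ k)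
    {X : Set (CProj n)} (hX : X ⊆ projZeroLocus F) :
    ForGenericSubspace n s fun W => Disjoint (projLinearSubspace W) X := by
  have hsum : ∀ (α : Fin s → Fin (n + 1) → ℂ) (y : Fin s → ℂ),
      (fun j => ∑ l, α l j * y l) = ∑ l, y l • α l := by
    intro α y
    ext j
    simp [mul_comm]
  obtain ⟨μ, hμ, hμ0⟩ := exists_eval_ne_zero_of_forall_eval_map_eq_zero
    (H := fun i => genericRestrict s (F i)) (d := d)
    (a₀ := fun u => a (Fin.castLE hs u.1) u.2) (fun i => (hF i).genericRestrict) fun y hy => by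
      simp only [eval_map_genericRestrict] at hy
      rw [hsum fun l => a (Fin.castLE hs l)] at hy
      have h1 := h0 _ (Submodule.sum_mem _ fun l _ =>
        Submodule.smul_mem _ _ (Submodule.subset_span ⟨_, rfl⟩)) hy
      exact funext <| Fintype.linearIndependent_iff.mp
        (ha.comp _ (Fin.castLE_injective hs)) y h1
  refine ⟨μ, fun h => hμ (by rw [h, map_zero]), fun A _ hA => ?_⟩
  refine Set.disjoint_left.mpr ?_
  intro p hp hpX
  obtain ⟨y, hy⟩ := (Submodule.mem_span_range_iff_exists_fun ℂ).mp
    (rep_mem_of_mem_projLinearSubspace hp)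
  refine hA (hμ0 _ y (fun hy0 => p.rep_nonzero ?_) fun i => ?_)
  · rw [← hy, hy0]
    simp
  · rw [eval_map_genericRestrict, hsum A, hy]
    exact hX hpX i

/-- A system of `k` forms in `ℙ^(k+r)` whose zero locus misses some linear subspace of dimension
`k - 1` has a pure dimensional zero locus of dimension `r`. -/
theorem isPureDimensional_of_linearIndependent {n r k : ℕ} (hk : k + r = n)
    {F : Fin k → MvPolynomial (Fin (n + 1)) ℂ} {d : ℕ} (hd : 0 < d)
    (hF : ∀ i, (F i).IsHomogeneous d) {a : Fin k → Fin (n + 1) → ℂ}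
    (ha : LinearIndependent ℂ a)
    (h0 : ∀ v ∈ Submodule.span ℂ (Set.range a), (∀ i, eval v (F i) = 0) → v = 0) :
    IsPureDimensional (projZeroLocus F) r := by
  have hF' : ∀ i, ∃ e, (F i).IsHomogeneous e := fun i => ⟨d, hF i⟩
  have hgen : ∀ X ⊆ projZeroLocus F, ∀ s : ℕ, s + r ≤ n →
      ForGenericSubspace n s fun W => Disjoint (projLinearSubspace W) X := fun X hX s hs =>
    forGenericSubspace_disjoint hF ha h0 (by omega) hX
  refine ⟨isProjVariety_projZeroLocus hF', ⟨fun W hW => ?_, hgen _ subset_rfl⟩,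
    fun X hX => ⟨fun W hW => ?_, hgen X hX.2.1⟩⟩
  all_goals
    obtain ⟨s, hs⟩ := Nat.exists_eq_add_of_le
      (show Module.finrank ℂ W ≤ n + 1 by simpa using W.finrank_le)
    obtain ⟨ℓ, hℓ, hℓW⟩ := exists_linear_forms W (s := s) (by simpa using hs.symm)
  · have hex : ∃ v : Fin (n + 1) → ℂ, v ≠ 0 ∧ (∀ i, eval v (F i) = 0) ∧ v ∈ W := by
      by_contra! hcon
      have h1 := card_le_card_of_forall_eval_eq_zero (σ := Fin (n + 1)) (ι := Fin k ⊕ Fin s)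
        (y := Sum.elim F ℓ) (d := Sum.elim (fun _ => d) fun _ => 1)
        (by rintro (i | i); exacts [hF i, hℓ i]) (by rintro (i | i); exacts [hd, one_pos])
        fun v hv => by
          by_contra hv0
          exact hcon v hv0 (fun i => hv (Sum.inl i)) ((hℓW v).mp fun i => hv (Sum.inr i))
      simp only [Fintype.card_sum, Fintype.card_fin] at h1
      omega
    obtain ⟨v, hv, hvF, hvW⟩ := hex
    exact ⟨Projectivization.mk ℂ v hv, (mk_mem_projLinearSubspace hv).mpr hvW,
      (mk_mem_projZeroLocus hF' v hv).mpr hvF⟩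
  · obtain ⟨𝔮, h𝔮, rfl⟩ := hX.exists_minimalPrimes hF'
    have hhom := homogeneousComponent_mem_of_mem_minimalPrimes hF' h𝔮
    obtain ⟨y, hy, hyL⟩ := exists_linear_forms (Submodule.span ℂ (Set.range a)) (s := r + 1)
      (by rw [finrank_span_eq_card ha]; simp; omega)
    obtain ⟨v, hv, hv𝔮, hvW⟩ := exists_ne_zero_of_mem_minimalPrimes hF hy (fun _ => hd)
      (fun _ => one_pos) (fun v hvF hvy => h0 v ((hyL v).mp hvy) hvF)
      (by simp; omega) h𝔮 hhom hℓ (fun _ => one_pos) (by simp; omega)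
    exact ⟨Projectivization.mk ℂ v hv, (mk_mem_projLinearSubspace hv).mpr ((hℓW v).mp hvW),
      mk_mem_idealLocus hhom v hv hv𝔮⟩

/-! ### Generic linear combinations of the equations -/

/-- A property of the generic `s`-dimensional linear subspace, `s ≤ n + 1`, holds for some. -/
theorem ForGenericSubspace.exists_linearIndependent {n s : ℕ}
    {Q : Submodule ℂ (Fin (n + 1) → ℂ) → Prop} (hQ : ForGenericSubspace n s Q) (hs : s ≤ n + 1) :
    ∃ a : Fin s → Fin (n + 1) → ℂ, LinearIndependent ℂ a ∧
      Q (Submodule.span ℂ (Set.range a)) := by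
  classical
  obtain ⟨P, hP, hPQ⟩ := hQ
  -- the leading maximal minor
  set D : MvPolynomial (Fin s × Fin (n + 1)) ℂ :=
    (Matrix.of fun i j : Fin s => X (i, Fin.castLE hs j)).det with hD
  have hDe : ∀ α, eval α D = (Matrix.of fun i j : Fin s => α (i, Fin.castLE hs j)).det := by
    intro α
    rw [hD, RingHom.map_det]
    congr 1
    ext i j
    simp
  have hD0 : D ≠ 0 := fun h => by
    have h1 := hDe fun u => if Fin.castLE hs u.1 = u.2 then 1 else 0
    have h2 : (Matrix.of fun i j : Fin s =>
        if Fin.castLE hs i = Fin.castLE hs j then (1 : ℂ) else 0) = 1 := by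
      ext i j
      simp [Matrix.one_apply]
    rw [h, map_zero] at h1
    simp only [h2, Matrix.det_one] at h1
    exact zero_ne_one h1
  obtain ⟨α, hα⟩ : ∃ α, eval α (P * D) ≠ 0 := by
    by_contra! h
    exact mul_ne_zero hP hD0 (MvPolynomial.funext fun α => by rw [h, map_zero])
  rw [map_mul, hDe] at hα
  have hind : LinearIndependent ℂ fun i j => α (i, j) := by
    have h1 := Matrix.linearIndependent_rows_of_det_ne_zero (right_ne_zero_of_mul hα)
    exact LinearIndependent.of_comp
      (LinearMap.funLeft ℂ ℂ (Fin.castLE hs)) h1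
  exact ⟨fun i j => α (i, j), hind, hPQ _ hind (left_ne_zero_of_mul hα)⟩

/-- If `f` has no common zeros on the linear subspace spanned by the rows of `a`, then neither
have `k` generic combinations of the `f`, where `k` is the dimension of this subspace. -/
theorem exists_polynomial_of_linearIndependent {n k m d : ℕ} (hk : 0 < k) (hd : 0 < d)
    {f : Fin m → MvPolynomial (Fin (n + 1)) ℂ} (hf : ∀ j, (f j).IsHomogeneous d)
    {a : Fin k → Fin (n + 1) → ℂ} (ha : LinearIndependent ℂ a)
    (h0 : ∀ v ∈ Submodule.span ℂ (Set.range a), (∀ j, eval v (f j) = 0) → v = 0) :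
    k ≤ m ∧ ∃ R : MvPolynomial (Fin k × Fin m) ℂ, R ≠ 0 ∧ R.totalDegree ≤ k * d ^ (k - 1) ∧
      ∀ Λ : Matrix (Fin k) (Fin m) ℂ, eval (fun u => Λ u.1 u.2) R ≠ 0 →
        ∀ v ∈ Submodule.span ℂ (Set.range a), (∀ i, eval v (lambdaSystem Λ f i) = 0) → v = 0 := by
  set g : Fin m → MvPolynomial (Fin k) ℂ := fun j =>
    aeval (fun i => ∑ l, C (a l i) * X l) (f j) with hg
  have hgh : ∀ j, (g j).IsHomogeneous d := fun j => by
    have := (hf j).aeval (fun i => ∑ l, C (a l i) * X l) (n := 1)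
      fun i => IsHomogeneous.sum _ _ _ fun l _ => isHomogeneous_C_mul_X _ _
    rwa [one_mul] at this
  have hge : ∀ y j, eval y (g j) = eval (∑ l, y l • a l) (f j) := by
    intro y j
    rw [hg, ← aeval_eq_eval, ← AlgHom.comp_apply, comp_aeval, aeval_eq_eval]
    congr 2
    ext i
    simp [mul_comm]
  have hg0 : ∀ y : Fin k → ℂ, (∀ j, eval y (g j) = 0) → y = 0 := by
    intro y hy
    refine funext (Fintype.linearIndependent_iff.mp ha y (h0 _ ?_ fun j => ?_))
    · exact Submodule.sum_mem _ fun l _ =>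
        Submodule.smul_mem _ _ (Submodule.subset_span ⟨l, rfl⟩)
    · rw [← hge, hy]
  have : Nonempty (Fin k) := ⟨⟨0, hk⟩⟩
  refine ⟨by simpa using card_le_card_of_forall_eval_eq_zero hgh (fun _ => hd) hg0, ?_⟩
  obtain ⟨R, hR, hRd, hRg⟩ := exists_chowForm hd hgh hg0
  refine ⟨R, hR, by simpa using hRd, fun Λ hΛ v hv h => ?_⟩
  obtain ⟨y, rfl⟩ := (Submodule.mem_span_range_iff_exists_fun ℂ).mp hv
  rw [hRg _ hΛ y fun i => ?_]
  · simp
  · simpa [lambdaSystem, hge] using h i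

theorem lambdaSystem_isHomogeneous {n k m d : ℕ} (Λ : Matrix (Fin k) (Fin m) ℂ)
    {f : Fin m → MvPolynomial (Fin (n + 1)) ℂ} (hf : ∀ j, (f j).IsHomogeneous d) (i : Fin k) :
    (lambdaSystem Λ f i).IsHomogeneous d :=
  IsHomogeneous.sum _ _ _ fun j _ => (hf j).C_mul _

/-- The maximal minor formed by the rows `e` of a matrix of variables. Where it does not vanish,
the matrix has full column rank. -/
theorem exists_polynomial_of_injective {α : Type*} {m : ℕ} {e : Fin m → α}
    (he : Function.Injective e) :
    ∃ D : MvPolynomial (α × Fin m) ℂ, D ≠ 0 ∧ D.totalDegree ≤ m ∧ (0 < m → eval 0 D = 0) ∧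
      ∀ Λ : α × Fin m → ℂ, eval Λ D ≠ 0 →
        ∀ y : Fin m → ℂ, (∀ u, ∑ j, Λ (u, j) * y j = 0) → y = 0 := by
  classical
  set D : MvPolynomial (α × Fin m) ℂ := (Matrix.of fun i j : Fin m => X (e i, j)).det with hD
  have hDe : ∀ Λ, eval Λ D = (Matrix.of fun i j : Fin m => Λ (e i, j)).det := by
    intro Λ
    rw [hD, RingHom.map_det]
    congr 1
    ext i j
    simp
  refine ⟨D, fun h => ?_, ?_, fun hm => ?_, fun Λ hΛ y hy => ?_⟩
  · have h1 := hDe fun u => if u.1 = e u.2 then 1 else 0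
    have h2 : (Matrix.of fun i j : Fin m => if e i = e j then (1 : ℂ) else 0) = 1 := by
      ext i j
      simp [Matrix.one_apply, he.eq_iff]
    rw [h, map_zero] at h1
    simp only [h2, Matrix.det_one] at h1
    exact zero_ne_one h1
  · rw [hD, Matrix.det_apply]
    refine totalDegree_finsetSum_le fun s _ => (totalDegree_smul_le _ _).trans ?_
    refine (totalDegree_finsetProd _ _).trans ?_
    simp
  · rw [hDe]
    exact Matrix.det_eq_zero_of_row_eq_zero ⟨0, hm⟩ fun j => by simp
  · rw [hDe] at hΛ
    refine Matrix.eq_zero_of_mulVec_eq_zero hΛ ?_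
    ext i
    simpa [Matrix.mulVec, dotProduct] using hy (e i)

theorem mainTheorem12 :
    ∃ C : ℕ, ∀ (n r m d N : ℕ) (f : Fin m → MvPolynomial (Fin (n + 1)) ℂ),
      r < n →
      (∀ j, (f j).IsHomogeneous d) →
      IsPureDimensional (projZeroLocus f) r →
      N = ⌈(m : ℚ) / ((n : ℚ) - (r : ℚ))⌉₊ →
      (∃ H : Set (Fin N × Fin (n - r) × Fin m → ℂ),
        IsHypersurfaceOfDegreeLE H (N * (n - r) * d ^ (n - r - 1) + m) ∧
        ∀ Λ : Fin N → Matrix (Fin (n - r)) (Fin m) ℂ,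
          (fun x : Fin N × Fin (n - r) × Fin m => Λ x.1 x.2.1 x.2.2) ∉ H →
            (∀ i, IsPureDimensional (projZeroLocus (lambdaSystem (Λ i) f)) r) ∧
            projZeroLocus f = ⋂ i, projZeroLocus (lambdaSystem (Λ i) f)) ∧
      N * (n - r) * d ^ (n - r - 1) + m ≤ C * (m * d ^ (n - r - 1)) := by
  classical
  refine ⟨3, fun n r m d N f hrn hf hV hN => ?_⟩
  have hf' : ∀ j, ∃ e, (f j).IsHomogeneous e := fun j => ⟨d, hf j⟩
  obtain ⟨k, rfl⟩ := Nat.exists_eq_add_of_le hrn.le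
  rw [Nat.add_sub_cancel_left]
  have hk : 0 < k := by omega
  obtain ⟨a, ha, hdisj⟩ := (hV.2.1.2 k (by omega)).exists_linearIndependent (by omega)
  have h0 : ∀ v ∈ Submodule.span ℂ (Set.range a), (∀ j, eval v (f j) = 0) → v = 0 := by
    intro v hv hvf
    by_contra hv0
    exact Set.disjoint_left.mp hdisj ((mk_mem_projLinearSubspace hv0).mpr hv)
      ((mk_mem_projZeroLocus hf' v hv0).mpr hvf)
  -- Constants have the zero locus `∅` or `ℙⁿ`: the former is met by no linear subspace, the
  -- latter by the span of `a`.
  have hd : 0 < d := by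
    rcases Nat.eq_zero_or_pos d with rfl | hd
    · exfalso
      obtain ⟨p, -, hp⟩ := hV.2.1.1 ⊤ (by simp)
      refine ha.ne_zero ⟨0, hk⟩ (h0 _ (Submodule.subset_span ⟨_, rfl⟩) fun j => ?_)
      have h1 := (hf j).eval_smul 0 p.rep
      have h2 := (hf j).eval_smul 0 (a ⟨0, hk⟩)
      rw [zero_smul, pow_zero, one_mul] at h1 h2
      rw [← h2, h1]
      exact hp j
    · exact hd
  obtain ⟨hkm, R, hR, hRd, hRΛ⟩ := exists_polynomial_of_linearIndependent hk hd hf ha h0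
  have hNq : N = ⌈(m : ℚ) / k⌉₊ := by
    rw [hN]
    push_cast
    rw [add_sub_cancel_left]
  have hkq : (0 : ℚ) < k := by exact_mod_cast hk
  have hmN : m ≤ N * k := by
    have h1 : (m : ℚ) / k ≤ N := hNq ▸ Nat.le_ceil _
    rw [div_le_iff₀ hkq] at h1
    exact_mod_cast h1
  have hNk : N * k < m + k := by
    have h1 : (N : ℚ) < m / k + 1 := by
      rw [hNq]
      exact Nat.ceil_lt_add_one (by positivity)
    have h2 : (N : ℚ) * k < m + k := by
      calc (N : ℚ) * k < (m / k + 1) * k := by gcongr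
        _ = m + k := by field_simp
    exact_mod_cast h2
  refine ⟨?_, ?_⟩
  · obtain ⟨e⟩ := Function.Embedding.nonempty_of_card_le (α := Fin m) (β := Fin N × Fin k)
      (by simpa using hmN)
    obtain ⟨D, hD, hDd, hD0, hDΛ⟩ := exists_polynomial_of_injective e.injective
    set D' : MvPolynomial (Fin N × Fin k × Fin m) ℂ :=
      rename (Equiv.prodAssoc (Fin N) (Fin k) (Fin m)) D with hD'
    set R' : Fin N → MvPolynomial (Fin N × Fin k × Fin m) ℂ := fun i =>
      rename (fun u => (i, u)) R with hR'
    have hP0 : D' * ∏ i, R' i ≠ 0 := by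
      refine mul_ne_zero ?_ (Finset.prod_ne_zero_iff.mpr fun i _ => ?_)
      · exact (map_ne_zero_iff _ (rename_injective _ (Equiv.injective _))).mpr hD
      · exact (map_ne_zero_iff _ (rename_injective _ (Prod.mk_right_injective i))).mpr hR
    refine ⟨{x | eval x (D' * ∏ i, R' i) = 0}, ⟨_, ?_, ?_, rfl⟩, fun Λ hΛ => ?_⟩
    · -- The minor vanishes at the zero matrix, so the product is not constant.
      rw [Nat.pos_iff_ne_zero, Ne, totalDegree_eq_zero_iff_eq_C]
      intro h
      have h1 : eval 0 (D' * ∏ i, R' i) = 0 := by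
        rw [map_mul, hD', eval_rename, Pi.zero_comp,
          hD0 (by omega), zero_mul]
      rw [h, eval_C] at h1
      rw [h1, map_zero] at h
      exact hP0 h
    · refine (totalDegree_mul _ _).trans ?_
      rw [add_comm]
      refine add_le_add ?_ ((totalDegree_rename_le _ _).trans hDd)
      refine (totalDegree_finsetProd _ _).trans ?_
      refine (Finset.sum_le_card_nsmul _ _ _ fun i _ =>
        (totalDegree_rename_le _ _).trans hRd).trans ?_
      simp [mul_assoc]
    · rw [Set.mem_ofPred_eq, map_mul, map_prod] at hΛ
      have hΛR : ∀ i, eval (fun u => Λ i u.1 u.2) R ≠ 0 := fun i => by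
        have := Finset.prod_ne_zero_iff.mp (right_ne_zero_of_mul hΛ) i (Finset.mem_univ i)
        rwa [hR', eval_rename] at this
      have hΛD := left_ne_zero_of_mul hΛ
      rw [hD', eval_rename] at hΛD
      refine ⟨fun i => isPureDimensional_of_linearIndependent (by omega) hd
        (lambdaSystem_isHomogeneous (Λ i) hf) ha (hRΛ (Λ i) (hΛR i)), ?_⟩
      ext p
      simp only [Set.mem_iInter]
      have hev : ∀ i l, eval p.rep (lambdaSystem (Λ i) f l) =
          ∑ j, Λ i l j * eval p.rep (f j) := fun i l => by simp [lambdaSystem]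
      refine ⟨fun hp i l => ?_, fun hp => ?_⟩
      · rw [hev]
        exact Finset.sum_eq_zero fun j _ => by rw [hp j, mul_zero]
      · refine congrFun (hDΛ _ hΛD (fun j => eval p.rep (f j)) ?_)
        rintro ⟨i, l⟩
        exact (hev i l).symm.trans (hp i l)
  · have h1 : 1 ≤ d ^ (k - 1) := Nat.one_le_pow _ _ hd
    have h2 : N * k ≤ 2 * m := by omega
    calc N * k * d ^ (k - 1) + m ≤ 2 * m * d ^ (k - 1) + m * d ^ (k - 1) :=
          add_le_add (Nat.mul_le_mul_right _ h2) (Nat.le_mul_of_pos_right m h1)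
      _ = 3 * (m * d ^ (k - 1)) := by ring
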